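/- Let $n\ge 2$, let $(Q,\mathbf g)$ be a smooth $n$-dimensional Riemannian or pseudo-Riemannian manifold, let $m$ be a positive integer and $c\in\mathbb R$. For an open set $U\subseteq Q$, let $\mathcal S(U)$ be the real vector space of all smooth functions $G:U\to\mathbb R$ such that $$\nabla_i\nabla_j G=-mc\,G\,g_{ij}\quad\text{on } U,$$ where $\nabla$ is the Levi-Civita connection, so that $\nabla_i\nabla_jG=\partial_i\partial_jG-\Gamma^k_{ij}\partial_kG$. Say that $\mathbf g$ has constant curvature $K$ on $U$ if its Riemann tensor satisfies $R_{hlij}=K(g_{jl}g_{hi}-g_{il}g_{hj})$ on $U$, where $R^k{}_{lij}=\partial_i\Gamma^k_{jl}-\partial_j\Gamma^k_{il}+\Gamma^h_{jl}\Gamma^k_{ih}-\Gamma^h_{il}\Gamma^k_{jh}$ and $R_{hlij}=g_{hk}R^k{}_{lij}$. (1) The equation has locally an $(n+1)$-dimensional space of solutions, i.e. every point of $Q$ has a connected open neighbourhood $U$ with $\dim\mathcal S(U)=n+1$, if and only if $\mathbf g$ has constant curvature $K=mc$ on $Q$. (2) If $U\subseteq Q$ is any nonempty connected open set (for instance $U=Q$,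 if $Q$ is connected) with $\dim\mathcal S(U)=n+1$, then $\mathbf g$ has constant curvature $mc$ on $U$. If moreover $c=0$, then $\mathbf g$ is locally flat on $U$: around each point of $U$ there are smooth coordinates in which the components $g_{ij}$ are constant. -/

import Mathlib

open scoped Manifold ContDiff

noncomputable section

/-- A smooth pseudo-Riemannian metric on an `n`-dimensional smooth manifold `Q`: a smooth field of
symmetric, non-degenerate bilinear forms on the tangent spaces (of any signature, so that
Riemannian metrics are included). -/
structure PseudoRiemannianMetric (n : ℕ) (Q : Type*) [TopologicalSpace Q]
    [ChartedSpace (EuclideanSpace ℝ (Fin n)) Q] [IsManifold (𝓡 n) ∞ Q] where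
  /-- the bilinear form on each tangent space -/
  form (p : Q) : TangentSpace (𝓡 n) p →L[ℝ] TangentSpace (𝓡 n) p →L[ℝ] ℝ
  symm (p : Q) (v w : TangentSpace (𝓡 n) p) : form p v w = form p w v
  nondegenerate (p : Q) (v : TangentSpace (𝓡 n) p) :
    (∀ w : TangentSpace (𝓡 n) p, form p v w = 0) → v = 0
  contMDiff : ContMDiff (𝓡 n)
    ((𝓡 n).prod 𝓘(ℝ, EuclideanSpace ℝ (Fin n) →L[ℝ] EuclideanSpace ℝ (Fin n) →L[ℝ] ℝ)) ∞
    (fun p ↦ Bundle.TotalSpace.mk'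
      (EuclideanSpace ℝ (Fin n) →L[ℝ] EuclideanSpace ℝ (Fin n) →L[ℝ] ℝ)
      (E := fun p : Q ↦ TangentSpace (𝓡 n) p →L[ℝ] TangentSpace (𝓡 n) p →L[ℝ] ℝ) p (form p))

/-- The `i`-th partial derivative `∂ᵢ f` of a real function on `ℝⁿ`. -/
def partialDeriv {n : ℕ} (i : Fin n) (f : EuclideanSpace ℝ (Fin n) → ℝ)
    (x : EuclideanSpace ℝ (Fin n)) : ℝ :=
  fderiv ℝ f x (EuclideanSpace.single i 1)

section partialDeriv

variable {n : ℕ} {f h : EuclideanSpace ℝ (Fin n) → ℝ} {S : Set (EuclideanSpace ℝ (Fin n))}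
  {x : EuclideanSpace ℝ (Fin n)}

theorem ContDiffOn.partialDeriv (hf : ContDiffOn ℝ ∞ f S) (hS : IsOpen S) (i : Fin n) :
    ContDiffOn ℝ ∞ (partialDeriv i f) S :=
  (hf.fderiv_of_isOpen hS (m := ∞) (by simp)).clm_apply contDiffOn_const

theorem ContDiffOn.differentiableAt_of_isOpen (hf : ContDiffOn ℝ ∞ f S) (hS : IsOpen S)
    (hx : x ∈ S) : DifferentiableAt ℝ f x :=
  (hf.contDiffAt (hS.mem_nhds hx)).differentiableAt (by simp)

theorem partialDeriv_congr {f₁ f₂ : EuclideanSpace ℝ (Fin n) → ℝ} (hS : IsOpen S) (hx : x ∈ S)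
    (H : ∀ y ∈ S, f₁ y = f₂ y) (i : Fin n) : partialDeriv i f₁ x = partialDeriv i f₂ x := by
  have : f₁ =ᶠ[nhds x] f₂ := Filter.eventually_of_mem (hS.mem_nhds hx) H
  simp only [partialDeriv, this.fderiv_eq]

theorem partialDeriv_add (hf : ContDiffOn ℝ ∞ f S) (hh : ContDiffOn ℝ ∞ h S) (hS : IsOpen S)
    (hx : x ∈ S) (i : Fin n) :
    partialDeriv i (fun y ↦ f y + h y) x = partialDeriv i f x + partialDeriv i h x := by
  simp [partialDeriv, fderiv_fun_add (hf.differentiableAt_of_isOpen hS hx)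
    (hh.differentiableAt_of_isOpen hS hx)]

theorem partialDeriv_const_mul (a : ℝ) (hf : ContDiffOn ℝ ∞ f S) (hS : IsOpen S)
    (hx : x ∈ S) (i : Fin n) :
    partialDeriv i (fun y ↦ a * f y) x = a * partialDeriv i f x := by
  simp [partialDeriv, fderiv_const_mul (hf.differentiableAt_of_isOpen hS hx)]

end partialDeriv

namespace PseudoRiemannianMetric

variable {n : ℕ} {Q : Type*} [TopologicalSpace Q] [ChartedSpace (EuclideanSpace ℝ (Fin n)) Q]
  [IsManifold (𝓡 n) ∞ Q] (g : PseudoRiemannianMetric n Q)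
  (e : OpenPartialHomeomorph Q (EuclideanSpace ℝ (Fin n)))

/-- The components `gᵢⱼ` of the metric in the chart `e`, as a matrix-valued function of the
coordinates `x ∈ e.target`; the `i`-th coordinate vector field is the image of the `i`-th standard
basis vector under the differential of `e.symm`. -/
def metricMatrix (x : EuclideanSpace ℝ (Fin n)) : Matrix (Fin n) (Fin n) ℝ :=
  Matrix.of fun i j ↦ g.form (e.symm x)
    (mfderiv (𝓡 n) (𝓡 n) e.symm x (EuclideanSpace.single i (1 : ℝ) : EuclideanSpace ℝ (Fin n)))
    (mfderiv (𝓡 n) (𝓡 n) e.symm x (EuclideanSpace.single j (1 : ℝ) : EuclideanSpace ℝ (Fin n)))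

/-- The Christoffel symbols of the Levi-Civita connection in the chart `e`:
`Γᵏᵢⱼ = ½ gᵏˡ (∂ᵢ gⱼₗ + ∂ⱼ gᵢₗ - ∂ₗ gᵢⱼ)`. -/
def christoffel (k i j : Fin n) (x : EuclideanSpace ℝ (Fin n)) : ℝ :=
  (1 / 2) * ∑ l, (g.metricMatrix e x)⁻¹ k l *
    (partialDeriv i (fun y ↦ g.metricMatrix e y j l) x
      + partialDeriv j (fun y ↦ g.metricMatrix e y i l) x
      - partialDeriv l (fun y ↦ g.metricMatrix e y i j) x)

/-- The components `∇ᵢ∇ⱼ G = ∂ᵢ∂ⱼ G - Γᵏᵢⱼ ∂ₖ G` of the Hessian of `G` in the chart `e`. -/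
def hessian (G : Q → ℝ) (i j : Fin n) (x : EuclideanSpace ℝ (Fin n)) : ℝ :=
  partialDeriv i (partialDeriv j (fun y ↦ G (e.symm y))) x
    - ∑ k, g.christoffel e k i j x * partialDeriv k (fun y ↦ G (e.symm y)) x

/-- The components `Rᵏₗᵢⱼ = ∂ᵢ Γᵏⱼₗ - ∂ⱼ Γᵏᵢₗ + Γʰⱼₗ Γᵏᵢₕ - Γʰᵢₗ Γᵏⱼₕ` of the Riemann curvature
tensor in the chart `e`. -/
def riemann (k l i j : Fin n) (x : EuclideanSpace ℝ (Fin n)) : ℝ :=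
  partialDeriv i (g.christoffel e k j l) x - partialDeriv j (g.christoffel e k i l) x
    + ∑ h, g.christoffel e h j l x * g.christoffel e k i h x
    - ∑ h, g.christoffel e h i l x * g.christoffel e k j h x

/-- The components `Rₕₗᵢⱼ = gₕₖ Rᵏₗᵢⱼ` of the covariant Riemann curvature tensor in the chart
`e`. -/
def riemannLow (h l i j : Fin n) (x : EuclideanSpace ℝ (Fin n)) : ℝ :=
  ∑ k, g.metricMatrix e x h k * g.riemann e k l i j x

/-- The metric has constant curvature `K` on `U`: in every chart of the (maximal) smooth atlas,
`Rₕₗᵢⱼ = K (gⱼₗ gₕᵢ - gᵢₗ gₕⱼ)` at every point of `U`. -/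
def HasConstantCurvatureOn (K : ℝ) (U : Set Q) : Prop :=
  ∀ e ∈ IsManifold.maximalAtlas (𝓡 n) ∞ Q, ∀ x ∈ e.target, e.symm x ∈ U → ∀ h l i j : Fin n,
    g.riemannLow e h l i j x =
      K * (g.metricMatrix e x j l * g.metricMatrix e x h i
        - g.metricMatrix e x i l * g.metricMatrix e x h j)

/-- The metric has constant curvature `K` on the whole manifold. -/
def HasConstantCurvature (K : ℝ) : Prop := g.HasConstantCurvatureOn K Set.univ

/-- The metric is locally flat on `U`: around each point of `U` there are smooth coordinates in
which the components of the metric are constant, i.e. `U` is locally isometric to a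
pseudo-Euclidean space. -/
def IsLocallyFlatOn (U : Set Q) : Prop :=
  ∀ p ∈ U, ∃ e ∈ IsManifold.maximalAtlas (𝓡 n) ∞ Q, p ∈ e.source ∧
    ∃ A : Matrix (Fin n) (Fin n) ℝ, ∀ x ∈ e.target, g.metricMatrix e x = A

/-- `G` is smooth on `U` and satisfies `∇ᵢ∇ⱼ G = -K G gᵢⱼ` at every point of `U`, in every chart of
the (maximal) smooth atlas. -/
def IsSolutionOn (K : ℝ) (U : Set Q) (G : Q → ℝ) : Prop :=
  ContMDiffOn (𝓡 n) 𝓘(ℝ, ℝ) ∞ G U ∧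
    ∀ e ∈ IsManifold.maximalAtlas (𝓡 n) ∞ Q, ∀ x ∈ e.target, e.symm x ∈ U → ∀ i j : Fin n,
      g.hessian e G i j x = -K * G (e.symm x) * g.metricMatrix e x i j

variable {e} {U : Set Q} {G G' : Q → ℝ} {K : ℝ}

set_option linter.unusedSectionVars false in
theorem contDiffOn_comp_symm (he : e ∈ IsManifold.maximalAtlas (𝓡 n) ∞ Q)
    (hG : ContMDiffOn (𝓡 n) 𝓘(ℝ, ℝ) ∞ G U) :
    ContDiffOn ℝ ∞ (fun y ↦ G (e.symm y)) (e.target ∩ e.symm ⁻¹' U) := by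
  rw [← contMDiffOn_iff_contDiffOn]
  exact hG.comp ((contMDiffOn_symm_of_mem_maximalAtlas he).mono Set.inter_subset_left)
    (fun x hx ↦ hx.2)

theorem hessian_add (hU : IsOpen U) (he : e ∈ IsManifold.maximalAtlas (𝓡 n) ∞ Q)
    (hG : ContMDiffOn (𝓡 n) 𝓘(ℝ, ℝ) ∞ G U) (hG' : ContMDiffOn (𝓡 n) 𝓘(ℝ, ℝ) ∞ G' U)
    (i j : Fin n) {x : EuclideanSpace ℝ (Fin n)} (hx : x ∈ e.target) (hxU : e.symm x ∈ U) :
    g.hessian e (G + G') i j x = g.hessian e G i j x + g.hessian e G' i j x := by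
  have hS : IsOpen (e.target ∩ e.symm ⁻¹' U) := e.symm.isOpen_inter_preimage hU
  have h1 := contDiffOn_comp_symm he hG
  have h2 := contDiffOn_comp_symm he hG'
  have hxS : x ∈ e.target ∩ e.symm ⁻¹' U := ⟨hx, hxU⟩
  simp only [hessian, Pi.add_apply]
  rw [partialDeriv_congr hS hxS (fun y hy ↦ partialDeriv_add h1 h2 hS hy j) i,
    partialDeriv_add (h1.partialDeriv hS j) (h2.partialDeriv hS j) hS hxS i]
  simp only [fun k ↦ partialDeriv_add h1 h2 hS hxS k, mul_add, Finset.sum_add_distrib]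
  ring

theorem hessian_smul (hU : IsOpen U) (he : e ∈ IsManifold.maximalAtlas (𝓡 n) ∞ Q)
    (hG : ContMDiffOn (𝓡 n) 𝓘(ℝ, ℝ) ∞ G U) (a : ℝ)
    (i j : Fin n) {x : EuclideanSpace ℝ (Fin n)} (hx : x ∈ e.target) (hxU : e.symm x ∈ U) :
    g.hessian e (a • G) i j x = a * g.hessian e G i j x := by
  have hS : IsOpen (e.target ∩ e.symm ⁻¹' U) := e.symm.isOpen_inter_preimage hU
  have h1 := contDiffOn_comp_symm he hG
  have hxS : x ∈ e.target ∩ e.symm ⁻¹' U := ⟨hx, hxU⟩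
  simp only [hessian, Pi.smul_apply, smul_eq_mul]
  rw [partialDeriv_congr hS hxS (fun y hy ↦ partialDeriv_const_mul a h1 hS hy j) i,
    partialDeriv_const_mul a (h1.partialDeriv hS j) hS hxS i]
  simp only [fun k ↦ partialDeriv_const_mul a h1 hS hxS k, mul_sub, Finset.mul_sum]
  congr 1
  exact Finset.sum_congr rfl fun k _ ↦ by ring

theorem isSolutionOn_zero (K : ℝ) (U : Set Q) : g.IsSolutionOn K U 0 := by
  refine ⟨contMDiffOn_const, fun e _ x _ _ i j ↦ ?_⟩
  have h0 : ∀ k : Fin n, partialDeriv k (fun _ ↦ (0 : ℝ)) = fun _ ↦ 0 := by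
    intro k; funext y; simp [partialDeriv]
  simp [hessian, h0]

theorem IsSolutionOn.add {g : PseudoRiemannianMetric n Q} (hU : IsOpen U)
    (hG : g.IsSolutionOn K U G) (hG' : g.IsSolutionOn K U G') : g.IsSolutionOn K U (G + G') := by
  refine ⟨hG.1.add hG'.1, fun e he x hx hxU i j ↦ ?_⟩
  rw [g.hessian_add hU he hG.1 hG'.1 i j hx hxU, hG.2 e he x hx hxU i j,
    hG'.2 e he x hx hxU i j, Pi.add_apply]
  ring

theorem IsSolutionOn.smul {g : PseudoRiemannianMetric n Q} (hU : IsOpen U) (a : ℝ)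
    (hG : g.IsSolutionOn K U G) : g.IsSolutionOn K U (a • G) := by
  have ha : ContMDiffOn (𝓡 n) 𝓘(ℝ, ℝ) ∞ (fun _ : Q ↦ a) U := contMDiffOn_const
  refine ⟨ha.smul hG.1, fun e he x hx hxU i j ↦ ?_⟩
  rw [g.hessian_smul hU he hG.1 a i j hx hxU, hG.2 e he x hx hxU i j,
    Pi.smul_apply, smul_eq_mul]
  ring

variable (K) in
/-- The linear space of solutions of `∇ᵢ∇ⱼ G = -K G gᵢⱼ` on the open set `U`, as a space of
functions on `U` (each is the restriction of a function on `Q` whose values off `U` are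
irrelevant). -/
def solutionSpace (U : TopologicalSpace.Opens Q) : Submodule ℝ (U → ℝ) :=
  Submodule.map (LinearMap.funLeft ℝ ℝ (Subtype.val : U → Q))
    { carrier := {G | g.IsSolutionOn K U G}
      zero_mem' := g.isSolutionOn_zero K U
      add_mem' := fun hG hG' ↦ hG.add U.isOpen hG'
      smul_mem' := fun a _ hG ↦ hG.smul U.isOpen a }

end PseudoRiemannianMetric

end

/-!
The theorem rests on the observation that the Hessian equation `∇∇G = -K G g` is a closed first order
linear system for the `1`-jet `Y = (G, dG)` of a solution: in a chart it reads `DY = A Y`, where `A`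
(`hessianSystem`) depends smoothly on the point and takes values in endomorphisms of a space of
dimension `n + 1`.

*Uniqueness.* A solution of `DY = A Y` that vanishes at one point of a ball vanishes on the ball, by
Grönwall's inequality along segments. Hence a solution of the Hessian equation on a connected open
set `U` is determined by its `1`-jet at one point, and the dimension of the solution space is `n + 1`
if and only if every `1`-jet at a given point of `U` comes from a solution
(`finrank_solutionSpace_eq_iff`).

*Necessity.* Differentiating the equation once more and using the symmetry of third derivatives gives
`dG (R(u, v) w - K (g(v, w) u - g(u, w) v)) = 0`. If the covector `dG` is arbitrary, the curvature is
constant and equal to `K`.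

*Sufficiency.* Constant curvature is the vanishing of the curvature of the connection `d - A`
(`IsLeviCivitaOn.isFlatSystemOn`), so the Frobenius theorem (`IsFlatSystemOn.exists_solution`)
produces, on a small ball in one chart, solutions with arbitrary `1`-jet at the centre. They are
defined by transport along rays. To see that `Y` is differentiable at `x`, with derivative `A Y`, the
transport along the ray to `x + h` is compared with the curve obtained from the transport along the
ray to `x` by the first order correction `A h Y`: by flatness, this curve satisfies the ray equation
up to an error `O(‖h‖ ^ 2)`, and Grönwall's inequality applies. No smooth dependence of ordinary
differential equations on parameters is required. That the function so constructed solves the equation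
in all charts follows from the transition rule of the Christoffel symbols
(`IsLeviCivitaOn.conn_change`).

*Flatness.* For `K = 0`, solutions `G₁, …, Gₙ` on `U` whose differentials at `p` form a basis are the
coordinates of a chart around `p`. In this chart the equation for the coordinate functions says that
the Christoffel symbols vanish, and so the components of the metric are constant on a ball.
-/

section HessianEquation

open Set Metric Filter Topology

-- nested spaces of continuous linear maps need a deeper instance search
set_option maxSynthPendingDepth 3

/-! ### Flat linear systems -/

section Frobenius

variable {E F : Type*} [NormedAddCommGroup E] [NormedSpace ℝ E] [NormedAddCommGroup F]
  [NormedSpace ℝ F]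

/-- A linear equation `y' = a(t) y` is solvable on all of `[0, 1]`. The bound `1 / 2` on `a` keeps the
solution at distance at most `‖y₀‖` from `y₀`, so one application of Picard-Lindelöf suffices. -/
theorem exists_linear_ODE_solution [CompleteSpace F] {a : ℝ → F →L[ℝ] F}
    (ha : ContinuousOn a (Icc 0 1)) (hb : ∀ t ∈ Icc (0 : ℝ) 1, ‖a t‖ ≤ 1 / 2) (y₀ : F) :
    ∃ y : ℝ → F, y 0 = y₀ ∧
      ∀ t ∈ Icc (0 : ℝ) 1, HasDerivWithinAt y (a t (y t)) (Icc 0 1) t := by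
  have key : IsPicardLindelof (fun t y ↦ a t y) (⟨0, by simp⟩ : Icc (0 : ℝ) 1) y₀ ‖y₀‖₊ 0 ‖y₀‖₊
      (1 / 2) := by
    refine ⟨fun t ht ↦ ?_, fun x _ ↦ ha.clm_apply continuousOn_const, fun t ht x hx ↦ ?_, by simp⟩
    · refine ((a t).lipschitz.weaken ?_).lipschitzOnWith
      exact_mod_cast hb t ht
    · have h1 : ‖x‖ ≤ 2 * ‖y₀‖ := by
        have h2 : ‖x - y₀‖ ≤ ‖y₀‖ := by simpa [dist_eq_norm] using hx
        have h3 := norm_add_le (x - y₀) y₀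
        rw [sub_add_cancel] at h3
        linarith
      calc ‖a t x‖ ≤ ‖a t‖ * ‖x‖ := (a t).le_opNorm x
        _ ≤ 1 / 2 * (2 * ‖y₀‖) := by gcongr; exact hb t ht
        _ = ‖y₀‖₊ := by simp
  exact key.exists_eq_forall_mem_Icc_hasDerivWithinAt₀

/-- Near an interior point, a smooth map is bounded, Lipschitz and approximated to second order by
its derivative, with one constant `M`; the radius can be taken with `M * r ≤ 1 / 2`. -/
theorem ContDiffOn.exists_ball_second_order_bound {H : Type*} [NormedAddCommGroup H]
    [NormedSpace ℝ H] {A : E → H} {S : Set E} (hS : IsOpen S) {x₀ : E} (hx₀ : x₀ ∈ S)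
    (hA : ContDiffOn ℝ ∞ A S) :
    ∃ r > 0, ∃ M ≥ 0, ball x₀ r ⊆ S ∧ M * r ≤ 1 / 2 ∧ (∀ x ∈ ball x₀ r, ‖A x‖ ≤ M) ∧
      (∀ x ∈ ball x₀ r, ∀ z ∈ ball x₀ r, ‖A z - A x‖ ≤ M * ‖z - x‖) ∧
      (∀ x ∈ ball x₀ r, ∀ z ∈ ball x₀ r,
        ‖A z - A x - fderiv ℝ A x (z - x)‖ ≤ M * ‖z - x‖ * ‖z - x‖) := by
  have hD : ContDiffOn ℝ ∞ (fderiv ℝ A) S := hA.fderiv_of_isOpen hS (by simp)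
  obtain ⟨K, s, hs, hKs⟩ := ((hA.contDiffAt (hS.mem_nhds hx₀)).of_le
    (by simp : (1 : WithTop ℕ∞) ≤ ∞)).exists_lipschitzOnWith
  obtain ⟨L, s', hs', hLs⟩ := ((hD.contDiffAt (hS.mem_nhds hx₀)).of_le
    (by simp : (1 : WithTop ℕ∞) ≤ ∞)).exists_lipschitzOnWith
  obtain ⟨B, hB⟩ : ∃ B : ℝ, ∀ᶠ x in 𝓝 x₀, ‖A x‖ ≤ B :=
    ⟨‖A x₀‖ + 1, ((hA.continuousOn.continuousAt (hS.mem_nhds hx₀)).norm.eventually_lt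
      continuousAt_const (by simp)).mono fun _ h ↦ h.le⟩
  obtain ⟨ρ, hρ, hball⟩ := Metric.mem_nhds_iff.1
    (inter_mem (inter_mem (inter_mem hs hs') hB) (hS.mem_nhds hx₀))
  set M : ℝ := max (max K L) B with hM
  have hKM : (K : ℝ) ≤ M := (le_max_left _ _).trans (le_max_left _ _)
  have hLM : (L : ℝ) ≤ M := (le_max_right _ _).trans (le_max_left _ _)
  have hBM : B ≤ M := le_max_right _ _
  have hM0 : 0 ≤ M := K.2.trans hKM
  refine ⟨min ρ (1 / (2 * (M + 1))), by positivity, M, hM0, ?_, ?_, ?_, ?_, ?_⟩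
  · exact fun x hx ↦ (hball (ball_subset_ball (min_le_left _ _) hx)).2
  · calc M * min ρ (1 / (2 * (M + 1))) ≤ (M + 1) * (1 / (2 * (M + 1))) := by
          gcongr
          · linarith
          · exact min_le_right _ _
      _ = 1 / 2 := by field_simp
  · exact fun x hx ↦ (hball (ball_subset_ball (min_le_left _ _) hx)).1.2.trans hBM
  · intro x hx z hz
    have hx' := (hball (ball_subset_ball (min_le_left _ _) hx)).1.1.1
    have hz' := (hball (ball_subset_ball (min_le_left _ _) hz)).1.1.1
    have h := hKs.dist_le_mul z hz' x hx'
    rw [dist_eq_norm, dist_eq_norm] at h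
    exact h.trans (by gcongr)
  · intro x hx z hz
    have hseg : segment ℝ x z ⊆ ball x₀ (min ρ (1 / (2 * (M + 1)))) :=
      (convex_ball _ _).segment_subset hx hz
    refine (convex_segment x z).norm_image_sub_le_of_norm_hasFDerivWithin_le' (f := A)
      (f' := fderiv ℝ A) (fun w hw ↦ ?_) (fun w hw ↦ ?_) (left_mem_segment ℝ x z)
      (right_mem_segment ℝ x z)
    · have hwS := (hball (ball_subset_ball (min_le_left _ _) (hseg hw))).2
      exact ((hA.contDiffAt (hS.mem_nhds hwS)).differentiableAt
        (by simp)).hasFDerivAt.hasFDerivWithinAt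
    · have hw' := (hball (ball_subset_ball (min_le_left _ _) (hseg hw))).1.1.2
      have hx' := (hball (ball_subset_ball (min_le_left _ _) hx)).1.1.2
      have h := hLs.dist_le_mul w hw' x hx'
      rw [dist_eq_norm, dist_eq_norm] at h
      have hwx : ‖w - x‖ ≤ ‖z - x‖ := norm_sub_le_of_mem_segment hw
      exact h.trans (by gcongr)

/-- The linear system `DY = A Y` is integrable: its curvature vanishes on `S`. -/
def IsFlatSystemOn (A : E → E →L[ℝ] F →L[ℝ] F) (S : Set E) : Prop :=
  ∀ x ∈ S, ∀ u v y, fderiv ℝ A x u v y + A x v (A x u y) = fderiv ℝ A x v u y + A x u (A x v y)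

/-- **Frobenius theorem for linear systems.** Near every point, a flat system `DY = A Y` has a
solution with any prescribed value at that point, on a ball independent of this value. -/
theorem IsFlatSystemOn.exists_solution [CompleteSpace F] {A : E → E →L[ℝ] F →L[ℝ] F} {S : Set E}
    (hflat : IsFlatSystemOn A S) (hS : IsOpen S) {x₀ : E} (hx₀ : x₀ ∈ S)
    (hA : ContDiffOn ℝ ∞ A S) :
    ∃ r > 0, ball x₀ r ⊆ S ∧ ∀ y₀ : F, ∃ Y : E → F, Y x₀ = y₀ ∧
      ∀ x ∈ ball x₀ r, HasFDerivAt Y ((A x).flip (Y x)) x := by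
  obtain ⟨r, hr, M, hM0, hrS, hMr, hbd, hlip, hsec⟩ := hA.exists_ball_second_order_bound hS hx₀
  refine ⟨r, hr, hrS, fun y₀ ↦ ?_⟩
  -- the ray from `x₀` to `x` stays in the ball
  have hray : ∀ x ∈ ball x₀ r, ∀ t ∈ Icc (0 : ℝ) 1, x₀ + t • (x - x₀) ∈ ball x₀ r :=
    fun x hx t ht ↦ (convex_ball x₀ r).add_smul_sub_mem (mem_ball_self hr) hx ht
  have hnorm : ∀ x ∈ ball x₀ r, ‖x - x₀‖ ≤ r := fun x hx ↦ (mem_ball_iff_norm.1 hx).le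
  have hAd : ∀ x ∈ ball x₀ r, HasFDerivAt A (fderiv ℝ A x) x := fun x hx ↦
    ((hA.contDiffAt (hS.mem_nhds (hrS hx))).differentiableAt (by simp)).hasFDerivAt
  have hrayd : ∀ x (t : ℝ), HasDerivAt (fun t : ℝ ↦ x₀ + t • (x - x₀)) (x - x₀) t := by
    intro x t
    simpa using ((hasDerivAt_id t).smul_const (x - x₀)).const_add x₀
  have hAray : ∀ x ∈ ball x₀ r, ∀ t ∈ Icc (0 : ℝ) 1, HasDerivAt (fun t ↦ A (x₀ + t • (x - x₀)))
      (fderiv ℝ A (x₀ + t • (x - x₀)) (x - x₀)) t := fun x hx t ht ↦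
    HasFDerivAt.comp_hasDerivAt (E := E →L[ℝ] F →L[ℝ] F)
      (f := fun t : ℝ ↦ x₀ + t • (x - x₀)) t (hAd _ (hray x hx t ht))
      (hrayd x t)
  have hAn : ∀ x ∈ ball x₀ r, ∀ t ∈ Icc (0 : ℝ) 1,
      ‖A (x₀ + t • (x - x₀)) (x - x₀)‖ ≤ 1 / 2 := fun x hx t ht ↦
    calc _ ≤ ‖A (x₀ + t • (x - x₀))‖ * ‖x - x₀‖ := ContinuousLinearMap.le_opNorm _ _
      _ ≤ M * r := by
        gcongr
        · exact hbd _ (hray x hx t ht)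
        · exact hnorm x hx
      _ ≤ 1 / 2 := hMr
  have hex : ∀ x ∈ ball x₀ r, ∃ y : ℝ → F, y 0 = y₀ ∧ ∀ t ∈ Icc (0 : ℝ) 1,
      HasDerivWithinAt y (A (x₀ + t • (x - x₀)) (x - x₀) (y t)) (Icc 0 1) t := by
    intro x hx
    refine exists_linear_ODE_solution (a := fun t ↦ A (x₀ + t • (x - x₀)) (x - x₀))
      ?_ (hAn x hx) y₀
    exact ContinuousOn.clm_apply (fun t ht ↦ (hAray x hx t ht).continuousAt.continuousWithinAt)
      continuousOn_const
  choose! y hy0 hy using hex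
  refine ⟨fun x ↦ y x 1, ?_, fun x hx ↦ ?_⟩
  · -- the ray to `x₀` is constant
    have hx := mem_ball_self (x := x₀) hr
    have hc := constant_of_has_deriv_right_zero (f := y x₀) (a := 0) (b := 1)
      (fun t ht ↦ (hy x₀ hx t ht).continuousWithinAt) (fun t ht ↦ by
        have := (hy x₀ hx t (Ico_subset_Icc_self ht)).mono_of_mem_nhdsWithin
          (Icc_mem_nhdsGE_of_mem ht)
        simpa using this)
    exact (hc 1 (by simp)).trans (hy0 x₀ hx)
  obtain ⟨B, hB⟩ : ∃ B, ∀ t ∈ Icc (0 : ℝ) 1, ‖y x t‖ ≤ B :=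
    isCompact_Icc.exists_bound_of_continuousOn fun t ht ↦ (hy x hx t ht).continuousWithinAt
  have hB0 : 0 ≤ B := (norm_nonneg _).trans (hB 0 (by simp))
  set C : ℝ := M * r * B + M * B + M * (r * (M * B)) + M * (M * B) with hC
  -- along the ray to `z = x + h`, the curve `y x t + A (t h) (y x t)` solves the equation up to an
  -- error of order `‖h‖ ^ 2`, by flatness
  have hest : ∀ z ∈ ball x₀ r,
      ‖y z 1 - y x 1 - A x (z - x) (y x 1)‖ ≤ gronwallBound 0 (1 / 2) (C * ‖z - x‖ ^ 2) 1 := by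
    intro z hz
    set h := z - x with hh
    set ξ := x - x₀ with hξ
    have hzx : z - x₀ = ξ + h := by simp [hh, hξ]
    set p : ℝ → E := fun t ↦ x₀ + t • ξ with hp
    have hpz : ∀ t : ℝ, x₀ + t • (z - x₀) = p t + t • h := by
      intro t; simp only [hp, hzx, smul_add, add_assoc]
    set u' : ℝ → F := fun t ↦ A (p t) ξ (y x t) +
      (A (p t) (t • h) (A (p t) ξ (y x t)) +
        (fderiv ℝ A (p t) ξ (t • h) (y x t) + A (p t) h (y x t))) with hu'
    have hu : ∀ t ∈ Icc (0 : ℝ) 1, HasDerivWithinAt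
        (fun t ↦ y x t + A (p t) (t • h) (y x t)) (u' t) (Icc 0 1) t := by
      intro t ht
      have h1 := hy x hx t ht
      have h2 : HasDerivWithinAt (fun t ↦ A (p t)) (fderiv ℝ A (p t) ξ) (Icc 0 1) t :=
        (hAray x hx t ht).hasDerivWithinAt
      have h3 : HasDerivWithinAt (fun t : ℝ ↦ t • h) h (Icc 0 1) t := by
        simpa using ((hasDerivAt_id t).smul_const h).hasDerivWithinAt
      have h4 := h1.add ((h2.clm_apply h3).clm_apply h1)
      refine h4.congr_deriv ?_
      simp only [hu', add_apply]
      abel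
    have hright : ∀ {f : ℝ → F} {f' : F} {t : ℝ}, t ∈ Ico (0 : ℝ) 1 →
        HasDerivWithinAt f f' (Icc 0 1) t → HasDerivWithinAt f f' (Ici t) t :=
      fun ht hf ↦ hf.mono_of_mem_nhdsWithin (Icc_mem_nhdsGE_of_mem ht)
    have hdiff : ∀ t ∈ Icc (0 : ℝ) 1, HasDerivWithinAt
        (fun t ↦ y z t - (y x t + A (p t) (t • h) (y x t)))
        (A (p t + t • h) (ξ + h) (y z t) - u' t) (Icc 0 1) t := by
      intro t ht
      have h1 := hy z hz t ht
      rw [hpz, hzx] at h1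
      exact h1.sub (hu t ht)
    have hgron := norm_le_gronwallBound_of_norm_deriv_right_le
      (f := fun t ↦ y z t - (y x t + A (p t) (t • h) (y x t)))
      (f' := fun t ↦ A (p t + t • h) (ξ + h) (y z t) - u' t)
      (δ := 0) (K := 1 / 2) (ε := C * ‖h‖ ^ 2) (a := 0) (b := 1)
      (fun t ht ↦ (hdiff t ht).continuousWithinAt)
      (fun t ht ↦ hright ht (hdiff t (Ico_subset_Icc_self ht)))
      (by simp [hy0 x hx, hy0 z hz]) ?_ 1 (by simp)
    · have e1 : p 1 = x := by simp [hp, hξ]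
      simpa only [e1, one_smul, sub_zero, sub_add_eq_sub_sub] using hgron
    intro t ht'
    have ht := Ico_subset_Icc_self ht'
    have htn : ‖t • h‖ ≤ ‖h‖ := by
      rw [norm_smul, Real.norm_eq_abs, abs_of_nonneg ht.1]
      exact mul_le_of_le_one_left (norm_nonneg _) ht.2
    have hpm : p t ∈ ball x₀ r := hray x hx t ht
    have hqm : p t + t • h ∈ ball x₀ r := by rw [← hpz]; exact hray z hz t ht
    have hfl := hflat (p t) (hrS hpm) ξ (t • h) (y x t)
    set Y := y x t with hYdef
    set P := A (p t) with hPdef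
    set R := A (p t + t • h) with hRdef
    set D := fderiv ℝ A (p t) with hDdef
    have hYB : ‖Y‖ ≤ B := hB t ht
    have hξr : ‖ξ‖ ≤ r := hnorm x hx
    have hPM : ‖P‖ ≤ M := hbd _ hpm
    have hRM : ‖R‖ ≤ M := hbd _ hqm
    have hRP : ‖R - P‖ ≤ M * ‖h‖ := by
      refine (hlip _ hpm _ hqm).trans ?_
      rw [add_sub_cancel_left]; gcongr
    have hRPD : ‖R - P - D (t • h)‖ ≤ M * ‖h‖ * ‖h‖ := by
      have := hsec _ hpm _ hqm
      rw [add_sub_cancel_left] at this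
      exact this.trans (by gcongr)
    have hop2 : ∀ (T : E →L[ℝ] F →L[ℝ] F) (w : E) (f : F), ‖T w f‖ ≤ ‖T‖ * ‖w‖ * ‖f‖ :=
      fun T w f ↦ T.le_opNorm₂ w f
    have hPY : ‖P (t • h) Y‖ ≤ M * ‖h‖ * B := (hop2 _ _ _).trans (by gcongr)
    have hsplit : R (ξ + h) (y z t) - u' t =
        R (ξ + h) (y z t - (Y + P (t • h) Y)) +
        ((R - P - D (t • h)) ξ Y + (R - P) h Y + (R - P) ξ (P (t • h) Y) + R h (P (t • h) Y)) := by
      have hfl' : u' t = P ξ Y + (D (t • h) ξ Y + P ξ (P (t • h) Y) + P h Y) := by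
        simp only [hu']
        rw [← hfl]
        abel
      rw [hfl']
      simp only [map_add, map_sub, add_apply, sub_apply]
      abel
    have hR12 : ‖R (ξ + h)‖ ≤ 1 / 2 := by
      have := hAn z hz t ht
      rwa [hpz, hzx] at this
    rw [hsplit]
    calc _ ≤ ‖R (ξ + h) (y z t - (Y + P (t • h) Y))‖ + (‖(R - P - D (t • h)) ξ Y‖ +
          ‖(R - P) h Y‖ + ‖(R - P) ξ (P (t • h) Y)‖ + ‖R h (P (t • h) Y)‖) := by
          refine (norm_add_le _ _).trans ?_
          gcongr
          exact norm_add₄_le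
      _ ≤ 1 / 2 * ‖y z t - (Y + P (t • h) Y)‖ + ((M * ‖h‖ * ‖h‖) * r * B + (M * ‖h‖) * ‖h‖ * B +
          (M * ‖h‖) * r * (M * ‖h‖ * B) + M * ‖h‖ * (M * ‖h‖ * B)) := by
          gcongr
          · exact ((R (ξ + h)).le_opNorm _).trans (by gcongr)
          · exact (hop2 _ _ _).trans (by gcongr)
          · exact (hop2 _ _ _).trans (by gcongr)
          · exact (hop2 _ _ _).trans (by gcongr)
          · exact (hop2 _ _ _).trans (by gcongr)
      _ = 1 / 2 * ‖y z t - (Y + P (t • h) Y)‖ + C * ‖h‖ ^ 2 := by rw [hC]; ring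
  have hO : (fun z ↦ y z 1 - y x 1 - A x (z - x) (y x 1)) =O[𝓝 x] fun z ↦ ‖z - x‖ ^ 2 := by
    refine Asymptotics.IsBigO.of_bound
      (gronwallBound 0 (1 / 2) C 1) ?_
    filter_upwards [isOpen_ball.mem_nhds hx] with z hz
    refine (hest z hz).trans (le_of_eq ?_)
    rw [gronwallBound_of_K_ne_0 (by norm_num), gronwallBound_of_K_ne_0 (by norm_num)]
    simp only [norm_pow, norm_norm]
    ring
  have h0 := hO.hasFDerivAt (𝕜 := ℝ) (by norm_num)
  have hlin : HasFDerivAt (fun z ↦ y x 1 + (A x).flip (y x 1) (z - x))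
      ((A x).flip (y x 1)) x := by
    simpa using (((A x).flip (y x 1)).hasFDerivAt.comp x
      ((hasFDerivAt_id x).sub_const x)).const_add (y x 1)
  have := h0.add hlin
  rw [zero_add] at this
  refine this.congr_of_eventuallyEq (Eventually.of_forall fun z ↦ ?_)
  simp

/-- Solutions are smooth, since the equation expresses `DY` through `Y`. -/
theorem contDiffOn_of_hasFDerivAt_linear {A : E → E →L[ℝ] F →L[ℝ] F} {S : Set E} (hS : IsOpen S)
    (hA : ContDiffOn ℝ ∞ A S) {Y : E → F} (hY : ∀ x ∈ S, HasFDerivAt Y ((A x).flip (Y x)) x) :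
    ContDiffOn ℝ ∞ Y S := by
  rw [contDiffOn_infty]
  intro k
  induction k with
  | zero => exact contDiffOn_zero.2 fun x hx ↦ (hY x hx).continuousAt.continuousWithinAt
  | succ k ih =>
    push_cast
    rw [contDiffOn_succ_iff_fderiv_of_isOpen hS]
    refine ⟨fun x hx ↦ (hY x hx).differentiableAt.differentiableWithinAt, by simp, ?_⟩
    have hk : ContDiffOn ℝ k A S := hA.of_le (by exact_mod_cast le_top)
    have : ContDiffOn ℝ k (fun x ↦ (A x).flip (Y x)) S :=
      ((LinearIsometryEquiv.contDiff (E := E →L[ℝ] F →L[ℝ] F) (F := F →L[ℝ] E →L[ℝ] F)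
        (ContinuousLinearMap.flipₗᵢ ℝ E F F)).comp_contDiffOn hk :
          ContDiffOn ℝ k (fun x ↦ (A x).flip) S).clm_apply ih
    exact this.congr fun x hx ↦ (hY x hx).fderiv

theorem eqOn_zero_ball_of_hasFDerivAt_linear {A : E → E →L[ℝ] F →L[ℝ] F} {x₀ : E} {r : ℝ}
    (hA : ContinuousOn A (ball x₀ r)) {Y : E → F}
    (hY : ∀ x ∈ ball x₀ r, HasFDerivAt Y ((A x).flip (Y x)) x) {z : E} (hz : z ∈ ball x₀ r)
    (hYz : Y z = 0) : ∀ x ∈ ball x₀ r, Y x = 0 := by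
  intro x hx
  have hseg : ∀ t ∈ Icc (0 : ℝ) 1, z + t • (x - z) ∈ ball x₀ r :=
    fun t ht ↦ (convex_ball x₀ r).add_smul_sub_mem hz hx ht
  have hrd : ∀ t : ℝ, HasDerivAt (fun t : ℝ ↦ z + t • (x - z)) (x - z) t := by
    intro t
    simpa using ((hasDerivAt_id t).smul_const (x - z)).const_add z
  obtain ⟨K, hK⟩ : ∃ K, ∀ t ∈ Icc (0 : ℝ) 1, ‖A (z + t • (x - z)) (x - z)‖ ≤ K :=
    isCompact_Icc.exists_bound_of_continuousOn
      ((hA.comp (fun t _ ↦ (hrd t).continuousAt.continuousWithinAt) hseg).clm_apply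
        continuousOn_const)
  have hd : ∀ t ∈ Icc (0 : ℝ) 1, HasDerivAt (fun t : ℝ ↦ Y (z + t • (x - z)))
      (A (z + t • (x - z)) (x - z) (Y (z + t • (x - z)))) t :=
    fun t ht ↦ HasFDerivAt.comp_hasDerivAt (f := fun t : ℝ ↦ z + t • (x - z)) t (hY _ (hseg t ht))
      (hrd t)
  have := eq_zero_of_abs_deriv_le_mul_abs_self_of_eq_zero_right (K := K) (a := 0) (b := 1)
    (fun t ht ↦ (hd t ht).continuousAt.continuousWithinAt)
    (fun t ht ↦ (hd t (Ico_subset_Icc_self ht)).hasDerivWithinAt) (by simpa using hYz)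
    (fun t ht ↦ (ContinuousLinearMap.le_opNorm _ _).trans
      (by gcongr; exact hK t (Ico_subset_Icc_self ht))) 1 (by simp)
  simpa using this

end Frobenius

/-! ### The Hessian equation of a Levi-Civita connection on a vector space -/

section LeviCivita

variable {E : Type*} [NormedAddCommGroup E] [NormedSpace ℝ E]

/-- On the open subset `S` of a vector space, `b` is a smooth field of symmetric non-degenerate
bilinear forms and `Γ` (the bilinear map with coefficients `Γᵏᵢⱼ`) is its Levi-Civita connection:
it is torsion free and `b` is parallel. -/
structure IsLeviCivitaOn (b : E → E →L[ℝ] E →L[ℝ] ℝ) (Γ : E → E →L[ℝ] E →L[ℝ] E) (S : Set E) :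
    Prop where
  isOpen : IsOpen S
  contDiffOn_form : ContDiffOn ℝ ∞ b S
  contDiffOn_conn : ContDiffOn ℝ ∞ Γ S
  form_symm : ∀ x ∈ S, ∀ u v, b x u v = b x v u
  nondegenerate : ∀ x ∈ S, ∀ u, (∀ v, b x u v = 0) → u = 0
  conn_symm : ∀ x ∈ S, ∀ u v, Γ x u v = Γ x v u
  fderiv_form : ∀ x ∈ S, ∀ w u v,
    fderiv ℝ b x w u v = b x (Γ x w u) v + b x u (Γ x w v)

/-- The Hessian equation `∇∇F = -K F b` at the point `x`. -/
def SolvesHessianAt (b : E → E →L[ℝ] E →L[ℝ] ℝ) (Γ : E → E →L[ℝ] E →L[ℝ] E) (K : ℝ) (F : E → ℝ)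
    (x : E) : Prop :=
  ∀ u v, fderiv ℝ (fderiv ℝ F) x u v = fderiv ℝ F x (Γ x u v) - K * F x * b x u v

/-- The curvature tensor `R(u, v) w` of the connection `Γ`. -/
noncomputable def curvature (Γ : E → E →L[ℝ] E →L[ℝ] E) (x u v w : E) : E :=
  fderiv ℝ Γ x u v w - fderiv ℝ Γ x v u w + Γ x u (Γ x v w) - Γ x v (Γ x u w)

/-- The connection `Γ` has curvature `R(u, v) w = K (b(v, w) u - b(u, w) v)` at `x`. -/
def HasConstantCurvatureAt (b : E → E →L[ℝ] E →L[ℝ] ℝ) (Γ : E → E →L[ℝ] E →L[ℝ] E) (K : ℝ)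
    (x : E) : Prop :=
  ∀ u v w, curvature Γ x u v w = K • (b x v w • u - b x u w • v)

theorem ContDiffOn.hasFDerivAt_of_isOpen {H : Type*} [NormedAddCommGroup H] [NormedSpace ℝ H]
    {f : E → H} {S : Set E} (hf : ContDiffOn ℝ ∞ f S) (hS : IsOpen S) {x : E} (hx : x ∈ S) :
    HasFDerivAt f (fderiv ℝ f x) x :=
  ((hf.contDiffAt (hS.mem_nhds hx)).differentiableAt (by simp)).hasFDerivAt

variable {b b' : E → E →L[ℝ] E →L[ℝ] ℝ} {Γ Γ' : E → E →L[ℝ] E →L[ℝ] E} {S S' : Set E} {K : ℝ}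
  {F : E → ℝ}

theorem IsLeviCivitaOn.mono (h : IsLeviCivitaOn b Γ S) (hS' : IsOpen S') (hsub : S' ⊆ S) :
    IsLeviCivitaOn b Γ S' :=
  ⟨hS', h.contDiffOn_form.mono hsub, h.contDiffOn_conn.mono hsub,
    fun x hx ↦ h.form_symm x (hsub hx), fun x hx ↦ h.nondegenerate x (hsub hx),
    fun x hx ↦ h.conn_symm x (hsub hx), fun x hx ↦ h.fderiv_form x (hsub hx)⟩

theorem SolvesHessianAt.congr_of_eventuallyEq {F' : E → ℝ} {x : E}
    (h : SolvesHessianAt b Γ K F x) (hF : F' =ᶠ[𝓝 x] F) : SolvesHessianAt b Γ K F' x := by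
  intro u v
  rw [hF.fderiv.fderiv_eq, hF.fderiv_eq, hF.eq_of_nhds]
  exact h u v

/-- The terms of the integrability condition that are proportional to `F` itself cancel, because
the form is parallel and the connection torsion free. -/
theorem IsLeviCivitaOn.fderiv_form_add_swap (h : IsLeviCivitaOn b Γ S) {x : E} (hx : x ∈ S)
    (u v w : E) :
    fderiv ℝ b x u v w + b x u (Γ x v w) = fderiv ℝ b x v u w + b x v (Γ x u w) := by
  rw [h.fderiv_form x hx, h.fderiv_form x hx, h.conn_symm x hx v u]
  ring

/-- The integrability condition of the Hessian equation, obtained by differentiating the equation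
and using the symmetry of third derivatives. -/
theorem IsLeviCivitaOn.fderiv_curvature_eq_zero (h : IsLeviCivitaOn b Γ S)
    (hF : ContDiffOn ℝ ∞ F S) (hsol : ∀ x ∈ S, SolvesHessianAt b Γ K F x) {x : E} (hx : x ∈ S)
    (u v w : E) :
    fderiv ℝ F x (curvature Γ x u v w - K • (b x v w • u - b x u w • v)) = 0 := by
  have hS := h.isOpen
  have hD : ContDiffOn ℝ ∞ (fderiv ℝ F) S := hF.fderiv_of_isOpen hS (by simp)
  have hDD : ContDiffOn ℝ ∞ (fderiv ℝ (fderiv ℝ F)) S := hD.fderiv_of_isOpen hS (by simp)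
  have third : ∀ u v w, fderiv ℝ (fderiv ℝ (fderiv ℝ F)) x u v w =
      fderiv ℝ F x (fderiv ℝ Γ x u v w) + fderiv ℝ (fderiv ℝ F) x u (Γ x v w)
        - (K * fderiv ℝ F x u * b x v w + K * F x * fderiv ℝ b x u v w) := by
    intro u v w
    have h1 : HasFDerivAt (fun y ↦ fderiv ℝ (fderiv ℝ F) y v w) _ x :=
      ((hDD.hasFDerivAt_of_isOpen hS hx).clm_apply (hasFDerivAt_const v x)).clm_apply
        (hasFDerivAt_const w x)
    have h2 : HasFDerivAt (fun y ↦ fderiv ℝ F y (Γ y v w) - K * F y * b y v w) _ x :=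
      ((hD.hasFDerivAt_of_isOpen hS hx).clm_apply
        (((h.contDiffOn_conn.hasFDerivAt_of_isOpen hS hx).clm_apply
          (hasFDerivAt_const v x)).clm_apply (hasFDerivAt_const w x))).sub
      (((hF.hasFDerivAt_of_isOpen hS hx).const_mul K).mul
        (((h.contDiffOn_form.hasFDerivAt_of_isOpen hS hx).clm_apply
          (hasFDerivAt_const v x)).clm_apply (hasFDerivAt_const w x)))
    have h3 := h1.unique (h2.congr_of_eventuallyEq
      (Filter.eventually_of_mem (hS.mem_nhds hx) fun y hy ↦ hsol y hy v w))
    have h4 := congrArg (fun T : E →L[ℝ] ℝ ↦ T u) h3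
    simp at h4
    rw [h4]
    ring
  have hsymm : fderiv ℝ (fderiv ℝ (fderiv ℝ F)) x u v = fderiv ℝ (fderiv ℝ (fderiv ℝ F)) x v u :=
    ((hD.contDiffAt (hS.mem_nhds hx)).isSymmSndFDerivAt (by simpa using ENat.LEInfty.out)) u v
  have hs := congrArg (fun T : E →L[ℝ] ℝ ↦ T w) hsymm
  simp only [third, hsol x hx _ _] at hs
  have hb := h.fderiv_form_add_swap hx u v w
  simp only [curvature, map_sub, map_add, map_smul, smul_eq_mul]
  linear_combination hs + K * F x * hb

/-- If every covector at `x` is the differential of a solution, the integrability condition holds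
for all covectors and forces constant curvature. -/
theorem IsLeviCivitaOn.hasConstantCurvatureAt_of_forall_exists
    (h : IsLeviCivitaOn b Γ S) {x : E} (hx : x ∈ S)
    (hex : ∀ α : E →L[ℝ] ℝ, ∃ F : E → ℝ, ContDiffOn ℝ ∞ F S ∧
      (∀ y ∈ S, SolvesHessianAt b Γ K F y) ∧ fderiv ℝ F x = α) :
    HasConstantCurvatureAt b Γ K x := by
  intro u v w
  rw [← sub_eq_zero]
  refine h.nondegenerate x hx _ fun z ↦ ?_
  obtain ⟨F, hF, hsol, hα⟩ := hex (b x z)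
  rw [h.form_symm x hx, ← hα]
  exact h.fderiv_curvature_eq_zero hF hsol hx u v w

/-- The transition rule of the Christoffel symbols under a change of coordinates `φ`, for which no
inverse is needed: its differential is bijective because `b'` is non-degenerate. -/
theorem IsLeviCivitaOn.conn_change [FiniteDimensional ℝ E] (h : IsLeviCivitaOn b Γ S)
    (h' : IsLeviCivitaOn b' Γ' S') {φ : E → E} (hφ : ContDiffOn ℝ ∞ φ S') (hmap : MapsTo φ S' S)
    (hb : ∀ y ∈ S', ∀ u v, b' y u v = b (φ y) (fderiv ℝ φ y u) (fderiv ℝ φ y v)) {y : E}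
    (hy : y ∈ S') (u v : E) :
    fderiv ℝ φ y (Γ' y u v) =
      Γ (φ y) (fderiv ℝ φ y u) (fderiv ℝ φ y v) + fderiv ℝ (fderiv ℝ φ) y u v := by
  have hS' := h'.isOpen
  have hinj : Function.Injective (fderiv ℝ φ y : E →ₗ[ℝ] E) := by
    rw [injective_iff_map_eq_zero]
    intro w hw
    refine h'.nondegenerate y hy w fun z ↦ ?_
    rw [hb y hy]
    have : fderiv ℝ φ y w = 0 := hw
    simp [this]
  have hsurj := LinearMap.injective_iff_surjective.1 hinj
  rw [← sub_eq_zero]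
  refine h.nondegenerate _ (hmap hy) _ fun w' ↦ ?_
  obtain ⟨w, rfl⟩ := hsurj w'
  change b (φ y) _ (fderiv ℝ φ y w) = 0
  have hD : ContDiffOn ℝ ∞ (fderiv ℝ φ) S' := hφ.fderiv_of_isOpen hS' (by simp)
  have hsymm : ∀ u v, fderiv ℝ (fderiv ℝ φ) y u v = fderiv ℝ (fderiv ℝ φ) y v u := fun u v ↦
    ((hφ.contDiffAt (hS'.mem_nhds hy)).isSymmSndFDerivAt (by simpa using ENat.LEInfty.out)) u v
  -- derivative of the components of the pulled back form
  have hder : ∀ w u v, fderiv ℝ b' y w u v =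
      fderiv ℝ b (φ y) (fderiv ℝ φ y w) (fderiv ℝ φ y u) (fderiv ℝ φ y v) +
      b (φ y) (fderiv ℝ (fderiv ℝ φ) y w u) (fderiv ℝ φ y v) +
      b (φ y) (fderiv ℝ φ y u) (fderiv ℝ (fderiv ℝ φ) y w v) := by
    intro w u v
    have h1 : HasFDerivAt (fun z ↦ b' z u v) _ y :=
      ((h'.contDiffOn_form.hasFDerivAt_of_isOpen hS' hy).clm_apply
        (hasFDerivAt_const u y)).clm_apply (hasFDerivAt_const v y)
    have h2 : HasFDerivAt (fun z ↦ b (φ z) (fderiv ℝ φ z u) (fderiv ℝ φ z v)) _ y :=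
      (((h.contDiffOn_form.hasFDerivAt_of_isOpen h.isOpen (hmap hy)).comp y
          (hφ.hasFDerivAt_of_isOpen hS' hy)).clm_apply
        ((hD.hasFDerivAt_of_isOpen hS' hy).clm_apply (hasFDerivAt_const u y))).clm_apply
        ((hD.hasFDerivAt_of_isOpen hS' hy).clm_apply (hasFDerivAt_const v y))
    have h3 := h1.unique (h2.congr_of_eventuallyEq
      (Filter.eventually_of_mem (hS'.mem_nhds hy) fun z hz ↦ hb z hz u v))
    have h4 := congrArg (fun T : E →L[ℝ] ℝ ↦ T w) h3
    simp at h4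
    rw [h4]
    ring
  have e : ∀ w u v, b (φ y) (fderiv ℝ φ y (Γ' y w u)) (fderiv ℝ φ y v) +
      b (φ y) (fderiv ℝ φ y u) (fderiv ℝ φ y (Γ' y w v)) =
      b (φ y) (Γ (φ y) (fderiv ℝ φ y w) (fderiv ℝ φ y u)) (fderiv ℝ φ y v) +
      b (φ y) (fderiv ℝ φ y u) (Γ (φ y) (fderiv ℝ φ y w) (fderiv ℝ φ y v)) +
      b (φ y) (fderiv ℝ (fderiv ℝ φ) y w u) (fderiv ℝ φ y v) +
      b (φ y) (fderiv ℝ φ y u) (fderiv ℝ (fderiv ℝ φ) y w v) := by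
    intro w u v
    rw [← hb y hy, ← hb y hy, ← h'.fderiv_form y hy, hder, h.fderiv_form _ (hmap hy)]
  -- the Koszul combination of the three permuted identities
  have e1 := e u v w
  have e2 := e v u w
  have e3 := e w u v
  have sb := h.form_symm _ (hmap hy)
  have sc := h.conn_symm _ (hmap hy)
  have sc' := h'.conn_symm y hy
  rw [sc' v u, sc (fderiv ℝ φ y v) (fderiv ℝ φ y u), hsymm v u, sb (fderiv ℝ φ y u),
    sb (fderiv ℝ φ y u), sb (fderiv ℝ φ y u)] at e2
  rw [sc' w u, sc' w v, sc (fderiv ℝ φ y w) (fderiv ℝ φ y u),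
    sc (fderiv ℝ φ y w) (fderiv ℝ φ y v), hsymm w u, hsymm w v, sb (fderiv ℝ φ y u),
    sb (fderiv ℝ φ y u), sb (fderiv ℝ φ y u)] at e3
  rw [sb (fderiv ℝ φ y v), sb (fderiv ℝ φ y v), sb (fderiv ℝ φ y v)] at e1
  simp only [map_sub, map_add, sub_apply, add_apply]
  rw [sb (fderiv ℝ φ y (Γ' y u w)), sb (Γ (φ y) (fderiv ℝ φ y u) (fderiv ℝ φ y w)),
    sb (fderiv ℝ (fderiv ℝ φ) y u w)] at e1 e3
  rw [sb (fderiv ℝ φ y (Γ' y v w)), sb (Γ (φ y) (fderiv ℝ φ y v) (fderiv ℝ φ y w)),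
    sb (fderiv ℝ (fderiv ℝ φ) y v w)] at e2 e3
  linear_combination (e1 + e2 - e3) / 2

/-- The Hessian equation does not depend on the coordinates. -/
theorem IsLeviCivitaOn.solvesHessianAt_comp [FiniteDimensional ℝ E] (h : IsLeviCivitaOn b Γ S)
    (h' : IsLeviCivitaOn b' Γ' S') {φ : E → E} (hφ : ContDiffOn ℝ ∞ φ S') (hmap : MapsTo φ S' S)
    (hb : ∀ y ∈ S', ∀ u v, b' y u v = b (φ y) (fderiv ℝ φ y u) (fderiv ℝ φ y v)) {y : E}
    (hy : y ∈ S') (hF : ContDiffOn ℝ ∞ F S) (hsol : SolvesHessianAt b Γ K F (φ y)) :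
    SolvesHessianAt b' Γ' K (F ∘ φ) y := by
  intro u v
  have hS' := h'.isOpen
  have hD : ContDiffOn ℝ ∞ (fderiv ℝ φ) S' := hφ.fderiv_of_isOpen hS' (by simp)
  have hDF : ContDiffOn ℝ ∞ (fderiv ℝ F) S := hF.fderiv_of_isOpen h.isOpen (by simp)
  have h1 : ∀ z ∈ S', fderiv ℝ (F ∘ φ) z = (fderiv ℝ F (φ z)).comp (fderiv ℝ φ z) := fun z hz ↦
    ((hF.hasFDerivAt_of_isOpen h.isOpen (hmap hz)).comp z
      (hφ.hasFDerivAt_of_isOpen hS' hz)).fderiv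
  have hcomp : ContDiffOn ℝ ∞ (F ∘ φ) S' := hF.comp hφ hmap
  have hDc : ContDiffOn ℝ ∞ (fderiv ℝ (F ∘ φ)) S' := hcomp.fderiv_of_isOpen hS' (by simp)
  have h2 : fderiv ℝ (fderiv ℝ (F ∘ φ)) y u v =
      fderiv ℝ (fderiv ℝ F) (φ y) (fderiv ℝ φ y u) (fderiv ℝ φ y v) +
        fderiv ℝ F (φ y) (fderiv ℝ (fderiv ℝ φ) y u v) := by
    have e1 : HasFDerivAt (fun z ↦ fderiv ℝ (F ∘ φ) z v) _ y :=
      (hDc.hasFDerivAt_of_isOpen hS' hy).clm_apply (hasFDerivAt_const v y)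
    have e2 : HasFDerivAt (fun z ↦ fderiv ℝ F (φ z) (fderiv ℝ φ z v)) _ y :=
      ((hDF.hasFDerivAt_of_isOpen h.isOpen (hmap hy)).comp y
        (hφ.hasFDerivAt_of_isOpen hS' hy)).clm_apply
        ((hD.hasFDerivAt_of_isOpen hS' hy).clm_apply (hasFDerivAt_const v y))
    have e3 := e1.unique (e2.congr_of_eventuallyEq
      (Filter.eventually_of_mem (hS'.mem_nhds hy) fun z hz ↦ by simp [h1 z hz]))
    have e4 := congrArg (fun T : E →L[ℝ] ℝ ↦ T u) e3
    simp at e4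
    rw [e4]
    ring
  rw [h2, hsol, h1 y hy, ContinuousLinearMap.comp_apply, h.conn_change h' hφ hmap hb hy, map_add,
    hb y hy, Function.comp_apply]
  ring

/-- The linear first order system satisfied by the jet `(F, dF)` of a solution of the Hessian
equation. -/
noncomputable def hessianSystem [FiniteDimensional ℝ E] (b : E → E →L[ℝ] E →L[ℝ] ℝ)
    (Γ : E → E →L[ℝ] E →L[ℝ] E) (K : ℝ) (x : E) :
    E →L[ℝ] (ℝ × (E →L[ℝ] ℝ)) →L[ℝ] (ℝ × (E →L[ℝ] ℝ)) :=
  LinearMap.toContinuousLinearMap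
    { toFun := fun u ↦ ((ContinuousLinearMap.apply ℝ ℝ u).comp (ContinuousLinearMap.snd ℝ _ _)).prod
        (((ContinuousLinearMap.compL ℝ E E ℝ).flip (Γ x u)).comp (ContinuousLinearMap.snd ℝ _ _)
          - (ContinuousLinearMap.fst ℝ _ _).smulRight (K • b x u))
      map_add' := fun u v ↦ by
        ext <;> simp <;> ring
      map_smul' := fun a u ↦ by
        ext <;> simp <;> ring }

variable [FiniteDimensional ℝ E]

theorem hessianSystem_apply (x u : E) (y : ℝ × (E →L[ℝ] ℝ)) :
    hessianSystem b Γ K x u y = (y.2 u, y.2.comp (Γ x u) - y.1 • K • b x u) := by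
  simp [hessianSystem]

theorem IsLeviCivitaOn.contDiffOn_hessianSystem (h : IsLeviCivitaOn b Γ S) :
    ContDiffOn ℝ ∞ (hessianSystem b Γ K) S := by
  refine contDiffOn_clm_apply.2 fun u ↦ contDiffOn_clm_apply.2 fun y ↦ ?_
  simp only [hessianSystem_apply]
  refine contDiffOn_const.prodMk ?_
  exact (contDiffOn_const.clm_comp (h.contDiffOn_conn.clm_apply contDiffOn_const)).sub
    (((h.contDiffOn_form.clm_apply contDiffOn_const).const_smul K).const_smul y.1)

/-- Constant curvature is exactly the flatness of the system for the jets of solutions. -/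
theorem IsLeviCivitaOn.isFlatSystemOn (h : IsLeviCivitaOn b Γ S)
    (hK : ∀ x ∈ S, HasConstantCurvatureAt b Γ K x) :
    IsFlatSystemOn (hessianSystem b Γ K) S := by
  intro x hx u v y
  have hS := h.isOpen
  have hfd : ∀ u v, fderiv ℝ (hessianSystem b Γ K) x u v y =
      (0, y.2.comp (fderiv ℝ Γ x u v) - y.1 • K • fderiv ℝ b x u v) := by
    intro u v
    have h1 : HasFDerivAt (fun z ↦ hessianSystem b Γ K z v y) _ x :=
      ((h.contDiffOn_hessianSystem.hasFDerivAt_of_isOpen hS hx).clm_apply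
        (hasFDerivAt_const v x)).clm_apply (hasFDerivAt_const y x)
    have h2 : HasFDerivAt (fun z ↦ (y.2 v, y.2.comp (Γ z v) - y.1 • K • b z v)) _ x :=
      (hasFDerivAt_const (y.2 v) x).prodMk
      (((hasFDerivAt_const y.2 x).clm_comp
        ((h.contDiffOn_conn.hasFDerivAt_of_isOpen hS hx).clm_apply (hasFDerivAt_const v x))).sub
      ((((h.contDiffOn_form.hasFDerivAt_of_isOpen hS hx).clm_apply
          (hasFDerivAt_const v x)).const_smul K).const_smul y.1))
    simp only [hessianSystem_apply] at h1
    have h4 := congrArg (fun T ↦ T u) (h1.unique h2)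
    simp at h4
    rw [h4]
  simp only [hfd, hessianSystem_apply]
  ext w
  · simp [h.conn_symm x hx u v, h.form_symm x hx u v]
  · simp
    have hc := congrArg y.2 (hK x hx u v w)
    simp only [curvature, map_sub, map_add, map_smul, smul_eq_mul] at hc
    linear_combination hc - K * y.1 * h.fderiv_form_add_swap hx u v w

theorem IsLeviCivitaOn.hasFDerivAt_jet (h : IsLeviCivitaOn b Γ S) (hF : ContDiffOn ℝ ∞ F S) {x : E}
    (hx : x ∈ S) (hsol : SolvesHessianAt b Γ K F x) :
    HasFDerivAt (fun y ↦ (F y, fderiv ℝ F y))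
      ((hessianSystem b Γ K x).flip (F x, fderiv ℝ F x)) x := by
  have hD : ContDiffOn ℝ ∞ (fderiv ℝ F) S := hF.fderiv_of_isOpen h.isOpen (by simp)
  refine ((hF.hasFDerivAt_of_isOpen h.isOpen hx).prodMk
    (hD.hasFDerivAt_of_isOpen h.isOpen hx)).congr_fderiv ?_
  ext u v
  · simp [hessianSystem_apply]
  · simp [hessianSystem_apply, hsol u v]
    ring

/-- A solution on a ball whose `1`-jet vanishes at one point is zero. -/
theorem IsLeviCivitaOn.eq_zero_of_jet_eq_zero (h : IsLeviCivitaOn b Γ S) {x₀ : E} {r : ℝ}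
    (hball : ball x₀ r ⊆ S) (hF : ContDiffOn ℝ ∞ F (ball x₀ r))
    (hsol : ∀ x ∈ ball x₀ r, SolvesHessianAt b Γ K F x) {z : E} (hz : z ∈ ball x₀ r)
    (h0 : F z = 0) (h1 : fderiv ℝ F z = 0) : ∀ x ∈ ball x₀ r, F x = 0 := by
  have hb := h.mono isOpen_ball hball
  intro x hx
  have := eqOn_zero_ball_of_hasFDerivAt_linear hb.contDiffOn_hessianSystem.continuousOn
    (fun y hy ↦ hb.hasFDerivAt_jet hF hy (hsol y hy)) hz (by simp [h0, h1]) x hx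
  exact congrArg Prod.fst this

/-- In constant curvature, every `1`-jet is the jet of a solution on a small ball. -/
theorem IsLeviCivitaOn.exists_solution (h : IsLeviCivitaOn b Γ S)
    (hK : ∀ x ∈ S, HasConstantCurvatureAt b Γ K x) {x₀ : E} (hx₀ : x₀ ∈ S) :
    ∃ r > 0, ball x₀ r ⊆ S ∧ ∀ (a : ℝ) (α : E →L[ℝ] ℝ), ∃ F : E → ℝ,
      ContDiffOn ℝ ∞ F (ball x₀ r) ∧ (∀ x ∈ ball x₀ r, SolvesHessianAt b Γ K F x) ∧
      F x₀ = a ∧ fderiv ℝ F x₀ = α := by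
  obtain ⟨r, hr, hrS, hex⟩ :=
    (h.isFlatSystemOn hK).exists_solution h.isOpen hx₀ h.contDiffOn_hessianSystem
  refine ⟨r, hr, hrS, fun a α ↦ ?_⟩
  obtain ⟨Y, hY0, hY⟩ := hex (a, α)
  have hYs := contDiffOn_of_hasFDerivAt_linear isOpen_ball
    (h.contDiffOn_hessianSystem.mono hrS) hY
  have hfst : ∀ x ∈ ball x₀ r, fderiv ℝ (fun y ↦ (Y y).1) x = (Y x).2 := by
    intro x hx
    rw [(hY x hx).fst.fderiv]
    ext u
    simp [hessianSystem_apply]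
  refine ⟨fun y ↦ (Y y).1, hYs.fst, fun x hx u v ↦ ?_, by simp [hY0], ?_⟩
  · have heq : fderiv ℝ (fun y ↦ (Y y).1) =ᶠ[𝓝 x] fun y ↦ (Y y).2 :=
      Filter.eventually_of_mem (isOpen_ball.mem_nhds hx) hfst
    rw [heq.fderiv_eq, (hY x hx).snd.fderiv, hfst x hx]
    simp [hessianSystem_apply]
    ring
  · rw [hfst x₀ (mem_ball_self hr), hY0]

end LeviCivita

/-! ### Coordinates and matrices -/

section Coordinates

variable {n : ℕ}

theorem EuclideanSpace.eq_sum_single (v : EuclideanSpace ℝ (Fin n)) :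
    v = ∑ i, v i • EuclideanSpace.single i (1 : ℝ) := by
  ext k
  simp [Finset.sum_apply, Pi.single_apply]

/-- Used to verify identities between multilinear expressions on the standard basis vectors. -/
theorem EuclideanSpace.induction_single {P : EuclideanSpace ℝ (Fin n) → Prop}
    (hadd : ∀ u v, P u → P v → P (u + v)) (hsmul : ∀ (a : ℝ) u, P u → P (a • u)) (h0 : P 0)
    (hs : ∀ i, P (EuclideanSpace.single i 1)) (v : EuclideanSpace ℝ (Fin n)) : P v := by
  rw [EuclideanSpace.eq_sum_single v]
  exact Finset.sum_induction _ P hadd h0 fun i _ ↦ hsmul _ _ (hs i)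

theorem EuclideanSpace.map_eq_sum_single (L : EuclideanSpace ℝ (Fin n) →L[ℝ] ℝ)
    (v : EuclideanSpace ℝ (Fin n)) : L v = ∑ k, v k * L (EuclideanSpace.single k 1) := by
  conv_lhs => rw [EuclideanSpace.eq_sum_single v]
  simp

theorem ContDiffOn.matrix_det {E : Type*} [NormedAddCommGroup E] [NormedSpace ℝ E] {S : Set E}
    {M : E → Matrix (Fin n) (Fin n) ℝ} (hM : ∀ i j, ContDiffOn ℝ ∞ (fun x ↦ M x i j) S) :
    ContDiffOn ℝ ∞ (fun x ↦ (M x).det) S := by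
  simp only [Matrix.det_apply']
  exact ContDiffOn.sum fun σ _ ↦ contDiffOn_const.mul (contDiffOn_prod fun i _ ↦ hM _ _)

theorem ContDiffOn.matrix_inv {E : Type*} [NormedAddCommGroup E] [NormedSpace ℝ E] {S : Set E}
    {M : E → Matrix (Fin n) (Fin n) ℝ} (hM : ∀ i j, ContDiffOn ℝ ∞ (fun x ↦ M x i j) S)
    (hdet : ∀ x ∈ S, (M x).det ≠ 0) (i j : Fin n) :
    ContDiffOn ℝ ∞ (fun x ↦ (M x)⁻¹ i j) S := by
  simp only [Matrix.inv_def, Ring.inverse_eq_inv', Matrix.smul_apply, smul_eq_mul]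
  refine ((ContDiffOn.matrix_det hM).inv hdet).mul ?_
  simp only [Matrix.adjugate_apply]
  refine ContDiffOn.matrix_det fun k l ↦ ?_
  by_cases hk : k = j
  · simp only [Matrix.updateRow_apply, hk, if_true]
    exact contDiffOn_const
  · simp only [Matrix.updateRow_apply, hk, if_false]
    exact hM k l

end Coordinates

/-! ### The metric and its connection in a chart -/

namespace PseudoRiemannianMetric

variable {n : ℕ} {Q : Type*} [TopologicalSpace Q] [ChartedSpace (EuclideanSpace ℝ (Fin n)) Q]
  {e e' : OpenPartialHomeomorph Q (EuclideanSpace ℝ (Fin n))}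

theorem contDiffOn_transition (he : e ∈ IsManifold.maximalAtlas (𝓡 n) ∞ Q)
    (he' : e' ∈ IsManifold.maximalAtlas (𝓡 n) ∞ Q) :
    ContDiffOn ℝ ∞ (fun y ↦ e (e'.symm y)) (e'.target ∩ e'.symm ⁻¹' e.source) := by
  rw [← contMDiffOn_iff_contDiffOn]
  exact (contMDiffOn_of_mem_maximalAtlas he).comp
    ((contMDiffOn_symm_of_mem_maximalAtlas he').mono inter_subset_left) (fun x hx ↦ hx.2)

variable [IsManifold (𝓡 n) ∞ Q] (g : PseudoRiemannianMetric n Q)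

/-- The metric in the chart `e`, as a bilinear form on the model space depending on the
coordinates. -/
noncomputable def chartForm (e : OpenPartialHomeomorph Q (EuclideanSpace ℝ (Fin n)))
    (x : EuclideanSpace ℝ (Fin n)) :
    EuclideanSpace ℝ (Fin n) →L[ℝ] EuclideanSpace ℝ (Fin n) →L[ℝ] ℝ :=
  ContinuousLinearMap.bilinearComp (E := EuclideanSpace ℝ (Fin n)) (F := EuclideanSpace ℝ (Fin n))
    (E' := EuclideanSpace ℝ (Fin n)) (F' := EuclideanSpace ℝ (Fin n)) (g.form (e.symm x))
    (mfderiv (𝓡 n) (𝓡 n) e.symm x) (mfderiv (𝓡 n) (𝓡 n) e.symm x)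

theorem chartForm_apply (x u v : EuclideanSpace ℝ (Fin n)) :
    g.chartForm e x u v = g.form (e.symm x) (mfderiv (𝓡 n) (𝓡 n) e.symm x u)
      (mfderiv (𝓡 n) (𝓡 n) e.symm x v) := rfl

theorem metricMatrix_eq_chartForm (x : EuclideanSpace ℝ (Fin n)) (i j : Fin n) :
    g.metricMatrix e x i j =
      g.chartForm e x (EuclideanSpace.single i 1) (EuclideanSpace.single j 1) := rfl

theorem contMDiffOn_mfderiv_symm (he : e ∈ IsManifold.maximalAtlas (𝓡 n) ∞ Q)
    (u : EuclideanSpace ℝ (Fin n)) :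
    ContMDiffOn (𝓡 n) ((𝓡 n).prod (𝓡 n)) ∞ (fun x ↦ Bundle.TotalSpace.mk'
      (EuclideanSpace ℝ (Fin n)) (E := fun p : Q ↦ TangentSpace (𝓡 n) p) (e.symm x)
      (mfderiv (𝓡 n) (𝓡 n) e.symm x u)) e.target := by
  have : IsManifold (𝓡 n) 1 Q := IsManifold.of_le (n := ∞) (by simp)
  have hT := (contMDiffOn_symm_of_mem_maximalAtlas he).contMDiffOn_tangentMapWithin (m := ∞)
    (by simp) e.open_target.uniqueMDiffOn
  have hs : ContMDiff (𝓡 n) ((𝓡 n).prod (𝓡 n)) ∞ (fun x : EuclideanSpace ℝ (Fin n) ↦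
      (⟨x, u⟩ : TangentBundle (𝓡 n) (EuclideanSpace ℝ (Fin n)))) :=
    (contMDiff_vectorSpace_iff_contDiff (V := fun _ ↦ u)).2 contDiff_const
  refine (hT.comp (t := _) hs.contMDiffOn (fun x hx ↦ hx)).congr fun x hx ↦ ?_
  simp [tangentMapWithin, mfderivWithin_of_isOpen e.open_target hx]

theorem contDiffOn_chartForm (he : e ∈ IsManifold.maximalAtlas (𝓡 n) ∞ Q) :
    ContDiffOn ℝ ∞ (g.chartForm e) e.target := by
  refine contDiffOn_clm_apply.2 fun u ↦ contDiffOn_clm_apply.2 fun v ↦ ?_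
  rw [← contMDiffOn_iff_contDiffOn]
  have : ContMDiffOn (𝓡 n) ((𝓡 n).prod 𝓘(ℝ)) ∞ (fun x ↦ Bundle.TotalSpace.mk' ℝ
      (E := Bundle.Trivial Q ℝ) (e.symm x) (g.chartForm e x u v)) e.target := by
    apply ContMDiffOn.clm_bundle_apply₂ (F₁ := EuclideanSpace ℝ (Fin n))
      (F₂ := EuclideanSpace ℝ (Fin n))
    · exact g.contMDiff.comp_contMDiffOn (contMDiffOn_symm_of_mem_maximalAtlas he)
    · exact contMDiffOn_mfderiv_symm he u
    · exact contMDiffOn_mfderiv_symm he v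
  intro x hx
  have h := this x hx
  simp only [Bundle.contMDiffWithinAt_totalSpace] at h
  exact h.2

theorem mfderiv_symm_bijective (he : e ∈ IsManifold.maximalAtlas (𝓡 n) ∞ Q)
    {x : EuclideanSpace ℝ (Fin n)} (hx : x ∈ e.target) :
    Function.Bijective (mfderiv (𝓡 n) (𝓡 n) e.symm x) := by
  have : IsManifold (𝓡 n) 1 Q := IsManifold.of_le (n := ∞) (by simp)
  have h : e.MDifferentiable (𝓡 n) (𝓡 n) :=
    ⟨(contMDiffOn_of_mem_maximalAtlas he).mdifferentiableOn (by simp),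
      (contMDiffOn_symm_of_mem_maximalAtlas he).mdifferentiableOn (by simp)⟩
  exact h.symm.mfderiv_bijective hx

theorem chartForm_symm (x u v : EuclideanSpace ℝ (Fin n)) :
    g.chartForm e x u v = g.chartForm e x v u := by
  simp only [chartForm_apply, g.symm]

theorem chartForm_nondegenerate (he : e ∈ IsManifold.maximalAtlas (𝓡 n) ∞ Q)
    {x : EuclideanSpace ℝ (Fin n)} (hx : x ∈ e.target) (u : EuclideanSpace ℝ (Fin n))
    (hu : ∀ v, g.chartForm e x u v = 0) : u = 0 := by
  have hb := mfderiv_symm_bijective he hx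
  refine hb.1 ((g.nondegenerate _ _ fun w ↦ ?_).trans (map_zero _).symm)
  obtain ⟨v, rfl⟩ := hb.2 w
  exact hu v

theorem metricMatrix_det_ne_zero (he : e ∈ IsManifold.maximalAtlas (𝓡 n) ∞ Q)
    {x : EuclideanSpace ℝ (Fin n)} (hx : x ∈ e.target) : (g.metricMatrix e x).det ≠ 0 := by
  intro h0
  obtain ⟨v, hv, hv0⟩ := Matrix.exists_mulVec_eq_zero_iff.2 h0
  refine hv ?_
  have hz : WithLp.toLp 2 v = (0 : EuclideanSpace ℝ (Fin n)) := by
    refine g.chartForm_nondegenerate he hx _ fun w ↦ ?_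
    rw [g.chartForm_symm]
    refine EuclideanSpace.induction_single (P := fun w ↦ g.chartForm e x w (WithLp.toLp 2 v) = 0)
      (fun a b ha hb ↦ by simp [ha, hb]) (fun a b hb ↦ by simp [hb]) (by simp) (fun i ↦ ?_) w
    have := congrFun hv0 i
    rw [EuclideanSpace.map_eq_sum_single]
    simpa [Matrix.mulVec, dotProduct, metricMatrix_eq_chartForm, mul_comm] using this
  simpa using congrArg (WithLp.ofLp (p := 2)) hz

theorem contDiffOn_metricMatrix (he : e ∈ IsManifold.maximalAtlas (𝓡 n) ∞ Q) (i j : Fin n) :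
    ContDiffOn ℝ ∞ (fun x ↦ g.metricMatrix e x i j) e.target :=
  ((g.contDiffOn_chartForm he).clm_apply contDiffOn_const).clm_apply contDiffOn_const

theorem contDiffOn_christoffel (he : e ∈ IsManifold.maximalAtlas (𝓡 n) ∞ Q) (k i j : Fin n) :
    ContDiffOn ℝ ∞ (g.christoffel e k i j) e.target := by
  have hm := g.contDiffOn_metricMatrix he
  have hp : ∀ l i j, ContDiffOn ℝ ∞ (partialDeriv l (fun y ↦ g.metricMatrix e y i j)) e.target :=
    fun l i j ↦ (hm i j).partialDeriv e.open_target l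
  exact contDiffOn_const.mul (ContDiffOn.sum fun l _ ↦
    (ContDiffOn.matrix_inv hm (fun x hx ↦ g.metricMatrix_det_ne_zero he hx) k l).mul
      (((hp i j l).add (hp j i l)).sub (hp l i j)))

/-- The Levi-Civita connection in the chart `e`, as the bilinear map with coefficients `Γᵏᵢⱼ`. -/
noncomputable def chartConn (e : OpenPartialHomeomorph Q (EuclideanSpace ℝ (Fin n)))
    (x : EuclideanSpace ℝ (Fin n)) :
    EuclideanSpace ℝ (Fin n) →L[ℝ] EuclideanSpace ℝ (Fin n) →L[ℝ] EuclideanSpace ℝ (Fin n) :=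
  ∑ i, ∑ j, ContinuousLinearMap.smulRight (EuclideanSpace.proj i : EuclideanSpace ℝ (Fin n) →L[ℝ] ℝ)
    (ContinuousLinearMap.smulRight (EuclideanSpace.proj j : EuclideanSpace ℝ (Fin n) →L[ℝ] ℝ)
      (WithLp.toLp 2 fun k ↦ g.christoffel e k i j x))

theorem chartConn_apply (x u v : EuclideanSpace ℝ (Fin n)) (k : Fin n) :
    g.chartConn e x u v k = ∑ i, ∑ j, u i * (v j * g.christoffel e k i j x) := by
  simp [chartConn, sum_apply, Finset.sum_apply]

theorem chartConn_single_single (x : EuclideanSpace ℝ (Fin n)) (i j : Fin n) :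
    g.chartConn e x (EuclideanSpace.single i 1) (EuclideanSpace.single j 1) =
      WithLp.toLp 2 fun k ↦ g.christoffel e k i j x := by
  ext k
  rw [chartConn_apply]
  simp

theorem contDiffOn_chartConn (he : e ∈ IsManifold.maximalAtlas (𝓡 n) ∞ Q) :
    ContDiffOn ℝ ∞ (g.chartConn e) e.target := by
  refine contDiffOn_clm_apply.2 fun u ↦ contDiffOn_clm_apply.2 fun v ↦ ?_
  rw [contDiffOn_euclidean]
  intro k
  simp only [chartConn_apply]
  exact ContDiffOn.sum fun i _ ↦ ContDiffOn.sum fun j _ ↦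
    contDiffOn_const.mul (contDiffOn_const.mul (g.contDiffOn_christoffel he k i j))

theorem partialDeriv_metricMatrix (he : e ∈ IsManifold.maximalAtlas (𝓡 n) ∞ Q)
    {x : EuclideanSpace ℝ (Fin n)} (hx : x ∈ e.target) (l i j : Fin n) :
    partialDeriv l (fun y ↦ g.metricMatrix e y i j) x =
      fderiv ℝ (g.chartForm e) x (EuclideanSpace.single l 1) (EuclideanSpace.single i 1)
        (EuclideanSpace.single j 1) := by
  have h := (((g.contDiffOn_chartForm he).hasFDerivAt_of_isOpen e.open_target hx).clm_apply
    (hasFDerivAt_const (EuclideanSpace.single i 1) x)).clm_apply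
    (hasFDerivAt_const (EuclideanSpace.single j 1) x)
  simp only [partialDeriv, metricMatrix_eq_chartForm]
  rw [h.fderiv]
  simp

/-- The Christoffel symbols of the first kind. -/
theorem chartForm_chartConn_single (he : e ∈ IsManifold.maximalAtlas (𝓡 n) ∞ Q)
    {x : EuclideanSpace ℝ (Fin n)} (hx : x ∈ e.target) (i j m : Fin n) :
    g.chartForm e x (EuclideanSpace.single m 1)
      (g.chartConn e x (EuclideanSpace.single i 1) (EuclideanSpace.single j 1)) =
    (1 / 2) * (partialDeriv i (fun y ↦ g.metricMatrix e y j m) x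
      + partialDeriv j (fun y ↦ g.metricMatrix e y i m) x
      - partialDeriv m (fun y ↦ g.metricMatrix e y i j) x) := by
  set c : Fin n → ℝ := fun l ↦ partialDeriv i (fun y ↦ g.metricMatrix e y j l) x
      + partialDeriv j (fun y ↦ g.metricMatrix e y i l) x
      - partialDeriv l (fun y ↦ g.metricMatrix e y i j) x with hc
  have hΓ : (fun k ↦ g.christoffel e k i j x) =
      (1 / 2 : ℝ) • Matrix.mulVec (g.metricMatrix e x)⁻¹ c := by
    funext k
    simp [christoffel, Matrix.mulVec, dotProduct, hc]
  have hm : Matrix.mulVec (g.metricMatrix e x) (fun k ↦ g.christoffel e k i j x) =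
      (1 / 2 : ℝ) • c := by
    rw [hΓ, Matrix.mulVec_smul, Matrix.mulVec_mulVec,
      Matrix.mul_nonsing_inv _ (isUnit_iff_ne_zero.2 (g.metricMatrix_det_ne_zero he hx)),
      Matrix.one_mulVec]
  change _ = 1 / 2 * c m
  rw [chartConn_single_single, EuclideanSpace.map_eq_sum_single]
  have := congrFun hm m
  simpa [Matrix.mulVec, dotProduct, metricMatrix_eq_chartForm, mul_comm] using this

theorem chartConn_symm (x : EuclideanSpace ℝ (Fin n)) (u v : EuclideanSpace ℝ (Fin n)) :
    g.chartConn e x u v = g.chartConn e x v u := by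
  have hc : ∀ k i j, g.christoffel e k i j x = g.christoffel e k j i x := by
    intro k i j
    have hs : (fun y ↦ g.metricMatrix e y i j) = fun y ↦ g.metricMatrix e y j i :=
      funext fun y ↦ by simp only [metricMatrix_eq_chartForm, g.chartForm_symm]
    unfold christoffel
    congr 1
    refine Finset.sum_congr rfl fun l _ ↦ ?_
    rw [show partialDeriv l (fun y ↦ g.metricMatrix e y i j) x =
      partialDeriv l (fun y ↦ g.metricMatrix e y j i) x by rw [hs]]
    ring
  ext k
  rw [chartConn_apply, chartConn_apply, Finset.sum_comm]
  refine Finset.sum_congr rfl fun j _ ↦ Finset.sum_congr rfl fun i _ ↦ ?_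
  rw [hc k i j]
  ring

/-- The Christoffel symbols define the Levi-Civita connection of the metric in the chart. -/
theorem isLeviCivitaOn_chart (he : e ∈ IsManifold.maximalAtlas (𝓡 n) ∞ Q) :
    IsLeviCivitaOn (g.chartForm e) (g.chartConn e) e.target := by
  refine ⟨e.open_target, g.contDiffOn_chartForm he, g.contDiffOn_chartConn he,
    fun x _ ↦ g.chartForm_symm x, fun x hx ↦ g.chartForm_nondegenerate he hx,
    fun x _ ↦ g.chartConn_symm x, fun x hx w u v ↦ ?_⟩
  have hbs : ∀ l i j : Fin n, partialDeriv l (fun y ↦ g.metricMatrix e y i j) x =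
      partialDeriv l (fun y ↦ g.metricMatrix e y j i) x := by
    intro l i j
    congr 1
    exact funext fun y ↦ by simp only [metricMatrix_eq_chartForm, g.chartForm_symm]
  induction w using EuclideanSpace.induction_single with
  | h0 => simp
  | hadd w w' h h' => simp only [map_add, add_apply, h, h']; ring
  | hsmul a w h => simp only [map_smul, smul_apply, h, smul_eq_mul]; ring
  | hs l =>
  induction u using EuclideanSpace.induction_single with
  | h0 => simp
  | hadd w w' h h' => simp only [map_add, add_apply, h, h']; ring
  | hsmul a w h => simp only [map_smul, smul_apply, h, smul_eq_mul]; ring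
  | hs i =>
  induction v using EuclideanSpace.induction_single with
  | h0 => simp
  | hadd w w' h h' => simp only [map_add, h, h']; ring
  | hsmul a w h => simp only [map_smul, h, smul_eq_mul]; ring
  | hs j =>
    rw [g.chartForm_symm x (g.chartConn e x _ _), g.chartForm_chartConn_single he hx,
      g.chartForm_chartConn_single he hx, ← g.partialDeriv_metricMatrix he hx, hbs l j i,
      hbs j l i, hbs i l j]
    ring

variable {G : Q → ℝ} {K : ℝ} {U : Set Q}

/-- The coordinate form of the Hessian equation. -/
theorem hessian_eq_iff (he : e ∈ IsManifold.maximalAtlas (𝓡 n) ∞ Q) (hU : IsOpen U)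
    (hG : ContMDiffOn (𝓡 n) 𝓘(ℝ, ℝ) ∞ G U) {x : EuclideanSpace ℝ (Fin n)} (hx : x ∈ e.target)
    (hxU : e.symm x ∈ U) :
    (∀ i j, g.hessian e G i j x = -K * G (e.symm x) * g.metricMatrix e x i j) ↔
      SolvesHessianAt (g.chartForm e) (g.chartConn e) K (fun y ↦ G (e.symm y)) x := by
  have hS : IsOpen (e.target ∩ e.symm ⁻¹' U) := e.symm.isOpen_inter_preimage hU
  have hF := contDiffOn_comp_symm he hG
  have hD : ContDiffOn ℝ ∞ (fderiv ℝ fun y ↦ G (e.symm y)) (e.target ∩ e.symm ⁻¹' U) :=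
    hF.fderiv_of_isOpen hS (by simp)
  have hh : ∀ i j, g.hessian e G i j x = fderiv ℝ (fderiv ℝ fun y ↦ G (e.symm y)) x
      (EuclideanSpace.single i 1) (EuclideanSpace.single j 1) -
      fderiv ℝ (fun y ↦ G (e.symm y)) x
        (g.chartConn e x (EuclideanSpace.single i 1) (EuclideanSpace.single j 1)) := by
    intro i j
    have h2 := (hD.hasFDerivAt_of_isOpen hS ⟨hx, hxU⟩).clm_apply
      (hasFDerivAt_const (EuclideanSpace.single j (1 : ℝ)) x)
    rw [hessian, chartConn_single_single,
      EuclideanSpace.map_eq_sum_single (fderiv ℝ (fun y ↦ G (e.symm y)) x) (WithLp.toLp 2 _)]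
    congr 1
    change fderiv ℝ (fun y ↦ fderiv ℝ (fun y ↦ G (e.symm y)) y (EuclideanSpace.single j 1)) x _ = _
    rw [h2.fderiv]
    simp
  refine ⟨fun h u v ↦ ?_, fun h i j ↦ ?_⟩
  · induction u using EuclideanSpace.induction_single with
    | h0 => simp
    | hadd w w' h h' => simp only [map_add, add_apply, h, h']; ring
    | hsmul a w h => simp only [map_smul, smul_apply, h, smul_eq_mul]; ring
    | hs i =>
    induction v using EuclideanSpace.induction_single with
    | h0 => simp
    | hadd w w' h h' => simp only [map_add, h, h']; ring
    | hsmul a w h => simp only [map_smul, h, smul_eq_mul]; ring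
    | hs j =>
      have := h i j
      rw [hh, metricMatrix_eq_chartForm] at this
      linear_combination this
  · rw [hh, h, metricMatrix_eq_chartForm]
    ring

theorem curvature_single (he : e ∈ IsManifold.maximalAtlas (𝓡 n) ∞ Q)
    {x : EuclideanSpace ℝ (Fin n)} (hx : x ∈ e.target) (k l i j : Fin n) :
    curvature (g.chartConn e) x (EuclideanSpace.single i 1) (EuclideanSpace.single j 1)
      (EuclideanSpace.single l 1) k = g.riemann e k l i j x := by
  have hd : ∀ i j, fderiv ℝ (g.chartConn e) x (EuclideanSpace.single i 1)
      (EuclideanSpace.single j 1) (EuclideanSpace.single l 1) k =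
      partialDeriv i (g.christoffel e k j l) x := by
    intro i j
    have h := (((g.contDiffOn_chartConn he).hasFDerivAt_of_isOpen e.open_target hx).clm_apply
      (hasFDerivAt_const (EuclideanSpace.single j (1 : ℝ)) x)).clm_apply
      (hasFDerivAt_const (EuclideanSpace.single l (1 : ℝ)) x)
    have h' := (EuclideanSpace.proj k : EuclideanSpace ℝ (Fin n) →L[ℝ] ℝ).hasFDerivAt.comp x h
    have hfun : g.christoffel e k j l = (EuclideanSpace.proj k : EuclideanSpace ℝ (Fin n) →L[ℝ] ℝ) ∘
        fun y ↦ g.chartConn e y (EuclideanSpace.single j 1) (EuclideanSpace.single l 1) := by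
      funext y
      simp [chartConn_single_single]
    rw [hfun, partialDeriv, h'.fderiv]
    simp
  have hq : ∀ i j, g.chartConn e x (EuclideanSpace.single i 1)
      (g.chartConn e x (EuclideanSpace.single j 1) (EuclideanSpace.single l 1)) k =
      ∑ h, g.christoffel e h j l x * g.christoffel e k i h x := by
    intro i j
    rw [chartConn_single_single, chartConn_apply]
    simp
  simp only [curvature, PiLp.sub_apply, PiLp.add_apply, hd, hq, riemann]

/-- The coordinate form of the condition of constant curvature. -/
theorem riemannLow_eq_iff (he : e ∈ IsManifold.maximalAtlas (𝓡 n) ∞ Q)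
    {x : EuclideanSpace ℝ (Fin n)} (hx : x ∈ e.target) :
    (∀ h l i j : Fin n, g.riemannLow e h l i j x =
      K * (g.metricMatrix e x j l * g.metricMatrix e x h i
        - g.metricMatrix e x i l * g.metricMatrix e x h j)) ↔
      HasConstantCurvatureAt (g.chartForm e) (g.chartConn e) K x := by
  have hlow : ∀ h l i j : Fin n, g.riemannLow e h l i j x =
      g.chartForm e x (EuclideanSpace.single h 1) (curvature (g.chartConn e) x
        (EuclideanSpace.single i 1) (EuclideanSpace.single j 1) (EuclideanSpace.single l 1)) := by
    intro h l i j
    rw [EuclideanSpace.map_eq_sum_single, riemannLow]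
    exact Finset.sum_congr rfl fun k _ ↦ by
      rw [g.curvature_single he hx, metricMatrix_eq_chartForm, mul_comm]
  refine ⟨fun H u v w ↦ ?_, fun H h l i j ↦ ?_⟩
  · induction u using EuclideanSpace.induction_single with
    | h0 => simp [curvature]
    | hadd u u' h h' =>
      simp only [curvature, map_add, add_apply] at h h' ⊢
      linear_combination (norm := module) h + h'
    | hsmul a u h =>
      simp only [curvature, map_smul, smul_apply] at h ⊢
      linear_combination (norm := module) a • h
    | hs i =>
    induction v using EuclideanSpace.induction_single with
    | h0 => simp [curvature]
    | hadd u u' h h' =>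
      simp only [curvature, map_add, add_apply] at h h' ⊢
      linear_combination (norm := module) h + h'
    | hsmul a u h =>
      simp only [curvature, map_smul, smul_apply] at h ⊢
      linear_combination (norm := module) a • h
    | hs j =>
    induction w using EuclideanSpace.induction_single with
    | h0 => simp [curvature]
    | hadd u u' h h' =>
      simp only [curvature, map_add] at h h' ⊢
      linear_combination (norm := module) h + h'
    | hsmul a u h =>
      simp only [curvature, map_smul] at h ⊢
      linear_combination (norm := module) a • h
    | hs l =>
      rw [← sub_eq_zero]
      refine g.chartForm_nondegenerate he hx _ fun z ↦ ?_
      rw [g.chartForm_symm]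
      induction z using EuclideanSpace.induction_single with
      | h0 => simp
      | hadd w w' h h' => rw [map_add, add_apply, h, h', add_zero]
      | hsmul a w h => rw [map_smul, smul_apply, h, smul_zero]
      | hs h =>
        have := H h l i j
        rw [hlow] at this
        rw [map_sub, this]
        simp only [metricMatrix_eq_chartForm, map_smul, map_sub, smul_eq_mul]
        ring
  · rw [hlow, H]
    simp only [metricMatrix_eq_chartForm, map_smul, map_sub, smul_eq_mul]

/-! ### Solutions on the manifold -/

/-- Tangent spaces at different points are identified with the model space, so that the form can be
transported along an equality of base points. -/
theorem form_congr {p q : Q} (h : p = q) (u v : EuclideanSpace ℝ (Fin n)) :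
    g.form p u v = g.form q u v := by
  subst h; rfl

theorem chartForm_transition (he : e ∈ IsManifold.maximalAtlas (𝓡 n) ∞ Q)
    (he' : e' ∈ IsManifold.maximalAtlas (𝓡 n) ∞ Q) {y : EuclideanSpace ℝ (Fin n)}
    (hy : y ∈ e'.target ∩ e'.symm ⁻¹' e.source) (u v : EuclideanSpace ℝ (Fin n)) :
    g.chartForm e' y u v = g.chartForm e (e (e'.symm y))
      (fderiv ℝ (fun y ↦ e (e'.symm y)) y u) (fderiv ℝ (fun y ↦ e (e'.symm y)) y v) := by
  have hS : IsOpen (e'.target ∩ e'.symm ⁻¹' e.source) := e'.symm.isOpen_inter_preimage e.open_source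
  have h1 : HasMFDerivAt (𝓡 n) (𝓡 n) (fun y ↦ e (e'.symm y)) y
      (fderiv ℝ (fun y ↦ e (e'.symm y)) y) :=
    ((contDiffOn_transition he he').hasFDerivAt_of_isOpen hS hy).hasMFDerivAt
  have h2 : HasMFDerivAt (𝓡 n) (𝓡 n) e.symm (e (e'.symm y))
      (mfderiv (𝓡 n) (𝓡 n) e.symm (e (e'.symm y))) :=
    (((contMDiffOn_symm_of_mem_maximalAtlas he).contMDiffAt
      (e.open_target.mem_nhds (e.map_source hy.2))).mdifferentiableAt (by simp)).hasMFDerivAt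
  have h3 := (h2.comp y h1).congr_of_eventuallyEq (f₁ := e'.symm)
    (Filter.eventually_of_mem (hS.mem_nhds hy) fun z hz ↦ (e.left_inv hz.2).symm)
  have h4 := h3.mfderiv
  rw [chartForm_apply, chartForm_apply, h4]
  exact g.form_congr (e.left_inv hy.2).symm _ _

theorem IsSolutionOn.solvesHessianAt {g : PseudoRiemannianMetric n Q} (hG : g.IsSolutionOn K U G)
    (hU : IsOpen U) (he : e ∈ IsManifold.maximalAtlas (𝓡 n) ∞ Q) {x : EuclideanSpace ℝ (Fin n)}
    (hx : x ∈ e.target ∩ e.symm ⁻¹' U) :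
    SolvesHessianAt (g.chartForm e) (g.chartConn e) K (fun y ↦ G (e.symm y)) x :=
  (g.hessian_eq_iff he hU hG.1 hx.1 hx.2).1 (hG.2 e he x hx.1 hx.2)

/-- A function that solves the Hessian equation in one chart around `U` solves it in all charts. -/
theorem isSolutionOn_of_chart (hU : IsOpen U) (hG : ContMDiffOn (𝓡 n) 𝓘(ℝ, ℝ) ∞ G U)
    (he : e ∈ IsManifold.maximalAtlas (𝓡 n) ∞ Q) (hUe : U ⊆ e.source)
    (hsol : ∀ x ∈ e.target ∩ e.symm ⁻¹' U,
      SolvesHessianAt (g.chartForm e) (g.chartConn e) K (fun y ↦ G (e.symm y)) x) :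
    g.IsSolutionOn K U G := by
  refine ⟨hG, fun e' he' y hy hyU ↦ (g.hessian_eq_iff he' hU hG hy hyU).2 ?_⟩
  have hS : IsOpen (e.target ∩ e.symm ⁻¹' U) := e.symm.isOpen_inter_preimage hU
  have hS' : IsOpen (e'.target ∩ e'.symm ⁻¹' U) := e'.symm.isOpen_inter_preimage hU
  have hsub : e'.target ∩ e'.symm ⁻¹' U ⊆ e'.target ∩ e'.symm ⁻¹' e.source :=
    fun z hz ↦ ⟨hz.1, hUe hz.2⟩
  have hmap : MapsTo (fun y ↦ e (e'.symm y)) (e'.target ∩ e'.symm ⁻¹' U)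
      (e.target ∩ e.symm ⁻¹' U) := fun z hz ↦ by
    refine ⟨e.map_source (hUe hz.2), ?_⟩
    simpa [e.left_inv (hUe hz.2)] using hz.2
  refine (((g.isLeviCivitaOn_chart he).mono hS inter_subset_left).solvesHessianAt_comp
    ((g.isLeviCivitaOn_chart he').mono hS' inter_subset_left)
    ((contDiffOn_transition he he').mono hsub) hmap
    (fun z hz ↦ g.chartForm_transition he he' (hsub hz)) ⟨hy, hyU⟩
    (contDiffOn_comp_symm he hG) (hsol _ (hmap ⟨hy, hyU⟩))).congr_of_eventuallyEq
    (Filter.eventually_of_mem (hS'.mem_nhds ⟨hy, hyU⟩) fun z hz ↦ ?_)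
  simp [e.left_inv (hUe hz.2)]

theorem IsSolutionOn.eq_zero_of_jet_eq_zero_of_ball {g : PseudoRiemannianMetric n Q}
    (hG : g.IsSolutionOn K U G) (hU : IsOpen U) (he : e ∈ IsManifold.maximalAtlas (𝓡 n) ∞ Q)
    {x₀ z : EuclideanSpace ℝ (Fin n)} {r : ℝ} (hball : ball x₀ r ⊆ e.target ∩ e.symm ⁻¹' U)
    (hz : z ∈ ball x₀ r) (h0 : G (e.symm z) = 0) (h1 : fderiv ℝ (fun y ↦ G (e.symm y)) z = 0)
    {q : Q} (hq : q ∈ e.source) (hqb : e q ∈ ball x₀ r) : G q = 0 := by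
  have := (g.isLeviCivitaOn_chart he).eq_zero_of_jet_eq_zero (F := fun y ↦ G (e.symm y))
    (fun y hy ↦ (hball hy).1) ((contDiffOn_comp_symm he hG.1).mono hball)
    (fun y hy ↦ hG.solvesHessianAt hU he (hball hy)) hz h0 h1 (e q) hqb
  simpa [e.left_inv hq] using this

/-- A solution on a connected open set is determined by its `1`-jet at one point. -/
theorem IsSolutionOn.eq_zero_of_jet_eq_zero {g : PseudoRiemannianMetric n Q}
    (hG : g.IsSolutionOn K U G) (hU : IsOpen U) (hUc : IsPreconnected U)
    (he : e ∈ IsManifold.maximalAtlas (𝓡 n) ∞ Q) {x : EuclideanSpace ℝ (Fin n)}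
    (hx : x ∈ e.target ∩ e.symm ⁻¹' U) (h0 : G (e.symm x) = 0)
    (h1 : fderiv ℝ (fun y ↦ G (e.symm y)) x = 0) : ∀ p ∈ U, G p = 0 := by
  -- the set of points near which `G` vanishes is open, and relatively closed in `U`
  have hsub : U ⊆ {p | ∀ᶠ q in 𝓝 p, G q = 0} := by
    refine hUc.subset_of_closure_inter_subset isOpen_setOfPred_eventually_nhds ?_ ?_
    · obtain ⟨r, hr, hball⟩ := Metric.isOpen_iff.1 (e.symm.isOpen_inter_preimage hU) x hx
      refine ⟨e.symm x, hx.2, ?_⟩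
      filter_upwards [(e.isOpen_inter_preimage isOpen_ball).mem_nhds
        (⟨e.map_target hx.1, by simpa [e.right_inv hx.1] using hr⟩ :
          e.symm x ∈ e.source ∩ e ⁻¹' ball x r)] with q hq
      exact hG.eq_zero_of_jet_eq_zero_of_ball hU he hball (mem_ball_self hr) h0 h1 hq.1 hq.2
    · rintro p ⟨hp, hpU⟩
      set c := chartAt (EuclideanSpace ℝ (Fin n)) p with hc
      have hcm : c ∈ IsManifold.maximalAtlas (𝓡 n) ∞ Q := IsManifold.chart_mem_maximalAtlas p
      have hps : p ∈ c.source := mem_chart_source _ p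
      obtain ⟨r, hr, hball⟩ := Metric.isOpen_iff.1 (c.symm.isOpen_inter_preimage hU) (c p)
        ⟨c.map_source hps, by simpa [c.left_inv hps] using hpU⟩
      have hV : IsOpen (c.source ∩ c ⁻¹' ball (c p) r) := c.isOpen_inter_preimage isOpen_ball
      have hpV : p ∈ c.source ∩ c ⁻¹' ball (c p) r := ⟨hps, mem_ball_self hr⟩
      obtain ⟨q, hqV, hq⟩ := mem_closure_iff.1 hp _ hV hpV
      have hev : (fun y ↦ G (c.symm y)) =ᶠ[𝓝 (c q)] fun _ ↦ 0 := by
        have ht := (c.continuousAt_symm (c.map_source hqV.1)).tendsto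
        rw [c.left_inv hqV.1] at ht
        exact ht.eventually hq
      filter_upwards [hV.mem_nhds hpV] with q' hq'
      refine hG.eq_zero_of_jet_eq_zero_of_ball hU hcm hball hqV.2 ?_ ?_ hq'.1 hq'.2
      · exact hev.eq_of_nhds
      · rw [hev.fderiv_eq]
        simp
  exact fun p hp ↦ (hsub hp).self_of_nhds

/-! ### Jets of solutions and the dimension of the solution space -/

/-- The functions on `Q` that solve the Hessian equation on `U`; the space `solutionSpace` consists
of their restrictions to `U`. -/
def globalSolutionSpace (K : ℝ) (U : TopologicalSpace.Opens Q) : Submodule ℝ (Q → ℝ) where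
  carrier := {G | g.IsSolutionOn K U G}
  zero_mem' := g.isSolutionOn_zero K U
  add_mem' := fun hG hG' ↦ hG.add U.isOpen hG'
  smul_mem' := fun a _ hG ↦ hG.smul U.isOpen a

section Jets

variable {U : TopologicalSpace.Opens Q} {x : EuclideanSpace ℝ (Fin n)}

theorem IsSolutionOn.differentiableAt {g : PseudoRiemannianMetric n Q} {G : Q → ℝ}
    (hG : g.IsSolutionOn K U G) (he : e ∈ IsManifold.maximalAtlas (𝓡 n) ∞ Q)
    (hx : x ∈ e.target ∩ e.symm ⁻¹' U) : DifferentiableAt ℝ (fun y ↦ G (e.symm y)) x :=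
  (contDiffOn_comp_symm he hG.1).differentiableAt_of_isOpen
    (e.symm.isOpen_inter_preimage U.isOpen) hx

/-- The `1`-jet of a solution at the point with coordinates `x`. -/
noncomputable def jet (K : ℝ) (he : e ∈ IsManifold.maximalAtlas (𝓡 n) ∞ Q)
    (hx : x ∈ e.target ∩ e.symm ⁻¹' U) :
    g.globalSolutionSpace K U →ₗ[ℝ] ℝ × (EuclideanSpace ℝ (Fin n) →L[ℝ] ℝ) where
  toFun G := (G.1 (e.symm x), fderiv ℝ (fun y ↦ G.1 (e.symm y)) x)
  map_add' G G' := by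
    have h := fderiv_fun_add (G.2.differentiableAt he hx) (G'.2.differentiableAt he hx)
    simpa using h
  map_smul' a G := by
    have h := fderiv_fun_const_smul (G.2.differentiableAt he hx) a
    simpa using h

theorem ker_jet (he : e ∈ IsManifold.maximalAtlas (𝓡 n) ∞ Q)
    (hx : x ∈ e.target ∩ e.symm ⁻¹' U) (hU : IsConnected (U : Set Q)) :
    LinearMap.ker (g.jet K he hx) = LinearMap.ker ((LinearMap.funLeft ℝ ℝ
      (Subtype.val : U → Q)).domRestrict (g.globalSolutionSpace K U)) := by
  ext G
  rw [LinearMap.mem_ker, LinearMap.mem_ker]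
  constructor
  · intro h
    have h0 : G.1 (e.symm x) = 0 := congrArg Prod.fst h
    have h1 : fderiv ℝ (fun y ↦ G.1 (e.symm y)) x = 0 := congrArg Prod.snd h
    funext p
    exact G.2.eq_zero_of_jet_eq_zero U.isOpen hU.isPreconnected he hx h0 h1 p p.2
  · intro h
    have hz : ∀ p ∈ U, G.1 p = 0 := fun p hp ↦ congrFun h ⟨p, hp⟩
    have hev : (fun y ↦ G.1 (e.symm y)) =ᶠ[𝓝 x] fun _ ↦ 0 :=
      Filter.eventually_of_mem ((e.symm.isOpen_inter_preimage U.isOpen).mem_nhds hx)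
        fun y hy ↦ hz _ hy.2
    refine Prod.ext (hz _ hx.2) ?_
    change fderiv ℝ (fun y ↦ G.1 (e.symm y)) x = 0
    rw [hev.fderiv_eq]
    simp

theorem finrank_jetSpace :
    Module.finrank ℝ (ℝ × (EuclideanSpace ℝ (Fin n) →L[ℝ] ℝ)) = n + 1 := by
  rw [Module.finrank_prod, Module.finrank_self,
    ← (LinearMap.toContinuousLinearMap (𝕜 := ℝ) (E := EuclideanSpace ℝ (Fin n))
      (F' := ℝ)).finrank_eq, Module.finrank_linearMap]
  simp [add_comm]

/-- On a connected open set the `1`-jet at a given point is injective on solutions, so the dimension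
is `n + 1` exactly when every `1`-jet at this point is the jet of a solution. -/
theorem finrank_solutionSpace_eq_iff (he : e ∈ IsManifold.maximalAtlas (𝓡 n) ∞ Q)
    (hx : x ∈ e.target ∩ e.symm ⁻¹' U) (hU : IsConnected (U : Set Q)) :
    Module.finrank ℝ (g.solutionSpace K U) = n + 1 ↔ Function.Surjective (g.jet K he hx) := by
  have h1 : g.solutionSpace K U = LinearMap.range ((LinearMap.funLeft ℝ ℝ
      (Subtype.val : U → Q)).domRestrict (g.globalSolutionSpace K U)) :=
    (LinearMap.range_domRestrict _ _).symm
  have h2 : Module.finrank ℝ (g.solutionSpace K U) =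
      Module.finrank ℝ (LinearMap.range (g.jet K he hx)) := by
    rw [h1, ← (LinearMap.quotKerEquivRange _).finrank_eq, ← g.ker_jet he hx hU,
      (LinearMap.quotKerEquivRange _).finrank_eq]
  rw [h2, ← LinearMap.range_eq_top]
  refine ⟨fun h ↦ Submodule.eq_top_of_finrank_eq (h.trans finrank_jetSpace.symm), fun h ↦ ?_⟩
  rw [h, finrank_top, finrank_jetSpace]

theorem hasConstantCurvatureOn_of_finrank (hU : IsConnected (U : Set Q))
    (hfin : Module.finrank ℝ (g.solutionSpace K U) = n + 1) :
    g.HasConstantCurvatureOn K U := by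
  intro e he x hx hxU
  have hsurj := (g.finrank_solutionSpace_eq_iff he ⟨hx, hxU⟩ hU).1 hfin
  refine (g.riemannLow_eq_iff he hx).2 ?_
  refine ((g.isLeviCivitaOn_chart he).mono (e.symm.isOpen_inter_preimage U.isOpen)
    inter_subset_left).hasConstantCurvatureAt_of_forall_exists ⟨hx, hxU⟩ fun α ↦ ?_
  obtain ⟨G, hG⟩ := hsurj (0, α)
  exact ⟨fun y ↦ G.1 (e.symm y), contDiffOn_comp_symm he G.2.1,
    fun y hy ↦ G.2.solvesHessianAt U.isOpen he hy, congrArg Prod.snd hG⟩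

theorem exists_finrank_of_hasConstantCurvature (hK : g.HasConstantCurvature K) (p : Q) :
    ∃ U : TopologicalSpace.Opens Q, p ∈ U ∧ IsConnected (U : Set Q) ∧
      Module.finrank ℝ (g.solutionSpace K U) = n + 1 := by
  set e := chartAt (EuclideanSpace ℝ (Fin n)) p with hedef
  have he : e ∈ IsManifold.maximalAtlas (𝓡 n) ∞ Q := IsManifold.chart_mem_maximalAtlas p
  have hp : p ∈ e.source := mem_chart_source _ p
  obtain ⟨r, hr, hball, hex⟩ := (g.isLeviCivitaOn_chart he).exists_solution (K := K)
    (fun x hx ↦ (g.riemannLow_eq_iff he hx).1 (hK e he x hx (mem_univ _))) (e.map_source hp)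
  set U : TopologicalSpace.Opens Q :=
    ⟨e.source ∩ e ⁻¹' ball (e p) r, e.isOpen_inter_preimage isOpen_ball⟩ with hUdef
  have hpU : p ∈ U := ⟨hp, mem_ball_self hr⟩
  have himage : (U : Set Q) = e.symm '' ball (e p) r := by
    rw [e.symm.image_eq_target_inter_inv_preimage hball]
    rfl
  have hUc : IsConnected (U : Set Q) := by
    rw [himage]
    exact ((convex_ball (e p) r).isConnected ⟨_, mem_ball_self hr⟩).image _
      (e.continuousOn_symm.mono hball)
  have hx : e p ∈ e.target ∩ e.symm ⁻¹' U :=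
    ⟨e.map_source hp, by simpa [e.left_inv hp] using hpU⟩
  refine ⟨U, hpU, hUc, (g.finrank_solutionSpace_eq_iff he hx hUc).2 ?_⟩
  rintro ⟨a, α⟩
  obtain ⟨F, hF, hsol, hF0, hF1⟩ := hex a α
  have hev : ∀ y ∈ ball (e p) r, (fun y ↦ F (e (e.symm y))) =ᶠ[𝓝 y] F := fun y hy ↦
    Filter.eventually_of_mem (isOpen_ball.mem_nhds hy) fun z hz ↦ by
      simp [e.right_inv (hball hz)]
  have hG : g.IsSolutionOn K U fun q ↦ F (e q) := by
    refine g.isSolutionOn_of_chart U.isOpen ?_ he inter_subset_left fun y hy ↦ ?_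
    · exact hF.contMDiffOn.comp ((contMDiffOn_of_mem_maximalAtlas he).mono inter_subset_left)
        fun q hq ↦ hq.2
    · have hyb : y ∈ ball (e p) r := by simpa [e.right_inv hy.1] using hy.2.2
      exact (hsol y hyb).congr_of_eventuallyEq (hev y hyb)
  refine ⟨⟨_, hG⟩, Prod.ext ?_ ?_⟩
  · change F (e (e.symm (e p))) = a
    rw [e.left_inv hp, hF0]
  · change fderiv ℝ (fun y ↦ F (e (e.symm y))) (e p) = α
    rw [(hev _ (mem_ball_self hr)).fderiv_eq, hF1]

/-- Functions whose differentials at `p` are the coordinate covectors are the coordinates of a chart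
around `p`, by the inverse function theorem. -/
theorem exists_chart_of_fderiv_eq_proj {V : Set Q} (hV : IsOpen V)
    (he : e ∈ IsManifold.maximalAtlas (𝓡 n) ∞ Q) {p : Q} (hp : p ∈ e.source) (hpV : p ∈ V)
    {G : Fin n → Q → ℝ} (hG : ∀ k, ContMDiffOn (𝓡 n) 𝓘(ℝ, ℝ) ∞ (G k) V)
    (hdG : ∀ k, fderiv ℝ (fun y ↦ G k (e.symm y)) (e p) = EuclideanSpace.proj k) :
    ∃ e' ∈ IsManifold.maximalAtlas (𝓡 n) ∞ Q, p ∈ e'.source ∧ e'.source ⊆ V ∧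
      Convex ℝ e'.target ∧ ∀ q ∈ e'.source, ∀ k, e' q k = G k q := by
  set f : EuclideanSpace ℝ (Fin n) → EuclideanSpace ℝ (Fin n) :=
    fun y ↦ WithLp.toLp 2 fun k ↦ G k (e.symm y) with hf
  have hS : IsOpen (e.target ∩ e.symm ⁻¹' V) := e.symm.isOpen_inter_preimage hV
  have hpS : e p ∈ e.target ∩ e.symm ⁻¹' V :=
    ⟨e.map_source hp, by simpa [e.left_inv hp] using hpV⟩
  have hfs : ContDiffOn ℝ ∞ f (e.target ∩ e.symm ⁻¹' V) := by
    rw [contDiffOn_euclidean]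
    exact fun k ↦ contDiffOn_comp_symm he (hG k)
  have hfd : HasFDerivAt f ((ContinuousLinearEquiv.refl ℝ (EuclideanSpace ℝ (Fin n)) :
      EuclideanSpace ℝ (Fin n) ≃L[ℝ] EuclideanSpace ℝ (Fin n)) :
      EuclideanSpace ℝ (Fin n) →L[ℝ] EuclideanSpace ℝ (Fin n)) (e p) := by
    rw [← hasFDerivWithinAt_univ, hasFDerivWithinAt_euclidean]
    intro k
    rw [hasFDerivWithinAt_univ]
    have := ((contDiffOn_comp_symm he (hG k)).hasFDerivAt_of_isOpen hS hpS)
    rw [hdG k] at this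
    exact this
  set Φ := (hfs.contDiffAt (hS.mem_nhds hpS)).toOpenPartialHomeomorph f hfd (by simp) with hΦ
  have hΦf : ∀ y, Φ y = f y := fun y ↦ rfl
  have hpΦ : e p ∈ Φ.source := ContDiffAt.mem_toOpenPartialHomeomorph_source _ hfd (by simp)
  -- the open set where the differential of `f` is invertible
  have hW : IsOpen ((e.target ∩ e.symm ⁻¹' V) ∩ fderiv ℝ f ⁻¹' range
      ((↑) : (EuclideanSpace ℝ (Fin n) ≃L[ℝ] EuclideanSpace ℝ (Fin n)) → _)) :=
    (hfs.fderiv_of_isOpen hS (m := ∞) (by simp)).continuousOn.isOpen_inter_preimage hS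
      ContinuousLinearEquiv.isOpen
  set W := (e.target ∩ e.symm ⁻¹' V) ∩ fderiv ℝ f ⁻¹' range
      ((↑) : (EuclideanSpace ℝ (Fin n) ≃L[ℝ] EuclideanSpace ℝ (Fin n)) → _) with hWdef
  have hpW : e p ∈ W := ⟨hpS, by rw [mem_preimage, hfd.fderiv]; exact ⟨_, rfl⟩⟩
  obtain ⟨r, hr, hball⟩ := Metric.isOpen_iff.1 (Φ.symm.isOpen_inter_preimage hW) (Φ (e p))
    ⟨Φ.map_source hpΦ, by
      change Φ.symm (Φ (e p)) ∈ W
      rwa [Φ.left_inv hpΦ]⟩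
  -- the chart `Φ ∘ e`, with its target cut down to the ball
  set T := e.trans Φ with hT
  have hTt : ball (Φ (e p)) r ⊆ T.target := fun y hy ↦ by
    rw [hT, OpenPartialHomeomorph.trans_target]
    exact ⟨(hball hy).1, (hball hy).2.1.1⟩
  set e' := (T.symm.restrOpen (ball (Φ (e p)) r) isOpen_ball).symm with he'
  have ht : e'.target = ball (Φ (e p)) r := by
    change T.target ∩ ball (Φ (e p)) r = _
    exact inter_eq_right.2 hTt
  have hval : ∀ q, e' q = Φ (e q) := fun q ↦ rfl
  have hsymm : ∀ y, e'.symm y = e.symm (Φ.symm y) := fun y ↦ rfl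
  have hsrc : ∀ q ∈ e'.source, q ∈ e.source ∧ e q ∈ W := by
    intro q hq
    have h1 : e' q ∈ ball (Φ (e p)) r := ht ▸ e'.map_source hq
    have h2 : q = e.symm (Φ.symm (e' q)) := by rw [← hsymm, e'.left_inv hq]
    have h3 := (hball h1).2
    change Φ.symm (e' q) ∈ W at h3
    have h4 : e q = Φ.symm (e' q) := by
      conv_lhs => rw [h2]
      exact e.right_inv h3.1.1
    refine ⟨?_, h4 ▸ h3⟩
    rw [h2]
    exact e.map_target h3.1.1
  have hes : e'.source ⊆ e.source := fun q hq ↦ (hsrc q hq).1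
  refine ⟨e', ?_, ?_, ?_, ?_, ?_⟩
  · refine OpenPartialHomeomorph.mem_maximalAtlas_of_contMDiffOn _ ?_ ?_
    · exact hfs.contMDiffOn.comp ((contMDiffOn_of_mem_maximalAtlas he).mono hes)
        fun q hq ↦ (hsrc q hq).2.1
    · have hΦs : ContDiffOn ℝ ∞ Φ.symm e'.target := by
        rw [ht]
        intro y hy
        obtain ⟨hy1, hyS, L, hL⟩ := hball hy
        refine (Φ.contDiffAt_symm hy1 (f₀' := L) ?_ ?_).contDiffWithinAt
        · rw [hL]
          exact hfs.hasFDerivAt_of_isOpen hS hyS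
        · exact hfs.contDiffAt (hS.mem_nhds hyS)
      refine (contMDiffOn_symm_of_mem_maximalAtlas he).comp hΦs.contMDiffOn fun y hy ↦ ?_
      rw [ht] at hy
      exact (hball hy).2.1.1
  · have : e'.symm (Φ (e p)) ∈ e'.source :=
      e'.map_target (by rw [ht]; exact mem_ball_self hr)
    rwa [hsymm, Φ.left_inv hpΦ, e.left_inv hp] at this
  · intro q hq
    have := (hsrc q hq).2.1.2
    rwa [mem_preimage, e.left_inv (hes hq)] at this
  · rw [ht]
    exact convex_ball _ _
  · intro q hq k
    rw [hval, hΦf, hf]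
    simp [e.left_inv (hes hq)]

/-- If the coordinate functions of a chart solve `∇∇G = 0`, the Christoffel symbols vanish, so that
the components of the metric are locally constant. -/
theorem isLocallyFlatOn_of_finrank (hU : IsConnected (U : Set Q))
    (hfin : Module.finrank ℝ (g.solutionSpace 0 U) = n + 1) : g.IsLocallyFlatOn U := by
  intro p hpU
  have he : chartAt (EuclideanSpace ℝ (Fin n)) p ∈ IsManifold.maximalAtlas (𝓡 n) ∞ Q :=
    IsManifold.chart_mem_maximalAtlas p
  have hp : p ∈ (chartAt (EuclideanSpace ℝ (Fin n)) p).source := mem_chart_source _ p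
  set e := chartAt (EuclideanSpace ℝ (Fin n)) p
  have hx : e p ∈ e.target ∩ e.symm ⁻¹' U :=
    ⟨e.map_source hp, by simpa [e.left_inv hp] using hpU⟩
  have hsurj := (g.finrank_solutionSpace_eq_iff he hx hU).1 hfin
  choose G hG using fun k : Fin n ↦
    hsurj (0, (EuclideanSpace.proj k : EuclideanSpace ℝ (Fin n) →L[ℝ] ℝ))
  obtain ⟨e', he', hp', hV, hconv, hcoord⟩ := exists_chart_of_fderiv_eq_proj U.isOpen he hp hpU
    (G := fun k ↦ (G k).1) (fun k ↦ (G k).2.1) (fun k ↦ congrArg Prod.snd (hG k))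
  have hLC := g.isLeviCivitaOn_chart he'
  -- the equation for the `k`-th coordinate function reads `Γᵏᵢⱼ = 0`
  have hΓ : ∀ y ∈ e'.target, ∀ u v, g.chartConn e' y u v = 0 := by
    intro y hy u v
    ext k
    have hev : (fun y ↦ (G k).1 (e'.symm y)) =ᶠ[𝓝 y]
        (EuclideanSpace.proj k : EuclideanSpace ℝ (Fin n) →L[ℝ] ℝ) :=
      Filter.eventually_of_mem (e'.open_target.mem_nhds hy) fun z hz ↦ by
        have h := hcoord _ (e'.map_target hz) k
        rw [e'.right_inv hz] at h
        exact h.symm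
    have hsol := ((G k).2.solvesHessianAt U.isOpen he'
      ⟨hy, hV (e'.map_target hy)⟩).congr_of_eventuallyEq hev.symm u v
    have hc : fderiv ℝ (EuclideanSpace.proj k : EuclideanSpace ℝ (Fin n) →L[ℝ] ℝ) =
        fun _ ↦ EuclideanSpace.proj k := funext fun z ↦ ContinuousLinearMap.fderiv _
    rw [hc] at hsol
    simpa using hsol.symm
  refine ⟨e', he', hp', g.metricMatrix e' (e' p), fun y hy ↦ ?_⟩
  have hconst : g.chartForm e' y = g.chartForm e' (e' p) := by
    refine hconv.is_const_of_fderivWithin_eq_zero (𝕜 := ℝ)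
      (hLC.contDiffOn_form.differentiableOn (by simp)) (fun z hz ↦ ?_) hy (e'.map_source hp')
    rw [fderivWithin_of_isOpen e'.open_target hz]
    ext w u v
    rw [hLC.fderiv_form z hz, hΓ z hz, hΓ z hz]
    simp
  ext i j
  rw [metricMatrix_eq_chartForm, metricMatrix_eq_chartForm, hconst]

end Jets

end PseudoRiemannianMetric

end HessianEquation

theorem mainTheorem3 (n : ℕ) (hn : 2 ≤ n) {Q : Type*} [TopologicalSpace Q]
    [ChartedSpace (EuclideanSpace ℝ (Fin n)) Q] [IsManifold (𝓡 n) ∞ Q]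
    (g : PseudoRiemannianMetric n Q) (m : ℕ) (hm : 0 < m) (c : ℝ) :
    -- every point has a connected open neighbourhood with an `(n+1)`-dimensional solution space
    -- if and only if the curvature is constant and equal to `mc`
    ((∀ p : Q, ∃ U : TopologicalSpace.Opens Q, p ∈ U ∧ IsConnected (U : Set Q) ∧
        Module.finrank ℝ (g.solutionSpace (m * c) U) = n + 1) ↔
      g.HasConstantCurvature (m * c)) ∧
    -- an `(n+1)`-dimensional solution space on any connected open set (such as `Q` itself, if it is
    -- connected) forces constant curvature `mc` there, and local flatness if `c = 0`
    (∀ U : TopologicalSpace.Opens Q, IsConnected (U : Set Q) →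
      Module.finrank ℝ (g.solutionSpace (m * c) U) = n + 1 →
        g.HasConstantCurvatureOn (m * c) U ∧ (c = 0 → g.IsLocallyFlatOn U)) := by
  refine ⟨⟨fun h e he x hx _ ↦ ?_, fun h p ↦ g.exists_finrank_of_hasConstantCurvature h p⟩,
    fun U hU hfin ↦ ⟨g.hasConstantCurvatureOn_of_finrank hU hfin, fun hc ↦ ?_⟩⟩
  · obtain ⟨U, hpU, hU, hfin⟩ := h (e.symm x)
    exact g.hasConstantCurvatureOn_of_finrank hU hfin e he x hx hpU
  · rw [hc, mul_zero] at hfin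
    exact g.isLocallyFlatOn_of_finrank hU hfin
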